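/- Let $d \ge 0$ be an integer, let $M \in \mathbb{R}^{d\times d}$ be symmetric positive semidefinite, let $r \in \mathbb{R}^d$ lie in the range of $M$, and put $$\ell(x) = \tfrac12\langle x, Mx\rangle - \langle r, x\rangle, \qquad \mathrm{Lasso}(x,\lambda) = \ell(x) + \lambda\|x\|_1, \qquad \mathrm{Lasso}_*(\lambda) = \min_{z\in\mathbb{R}^d} \mathrm{Lasso}(z,\lambda).$$ Write $a_+ = \max(a,0)$, $a_- = \max(-a,0)$ for real $a$, and $u\circ v$ for the componentwise product of vectors. Let $\beta,\gamma\in\mathbb{R}^d$ satisfy $\beta_i \ne \pm\gamma_i$ for all $i$. For small $\varepsilon>0$ let $(u^\varepsilon,v^\varepsilon)$ be the solution on $[0,\infty)$ of the gradient flow $$\frac{du}{dt} = -\nabla_u\big(\ell(u\circ v)\big), \qquad \frac{dv}{dt} = -\nabla_v\big(\ell(u\circ v)\big), \qquad u^\varepsilon(0) = \sqrt{\varepsilon}\,\beta,\quad v^\varepsilon(0) = \sqrt{\varepsilon}\,\gamma ,$$ and let, for $s>0$, $$\overline{x}^\varepsilon(s) = \frac1t\int_0^t u^\varepsilon(\tau)\circ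 v^\varepsilon(\tau)\,d\tau \qquad\text{with } t = \tfrac12 \log\big(\tfrac1\varepsilon\big)\, s .$$ Then there exists a constant $C = C(d,M,r,\beta,\gamma) > 0$ with the following property. For all $s>0$, let $x(s)$ be a minimizer of $\mathrm{Lasso}(\cdot,1/s)$ over $\mathbb{R}^d$, and assume that $s\mapsto x(s)$ is absolutely continuous on compact subsets of $(0,+\infty)$. Let $$z^{\downarrow}(s) = \sum_{i=1}^d \int_0^s \left[\left(\frac{d}{d\tau}\big(\tau\, x_i(\tau)_+\big)\right)_- + \left(\frac{d}{d\tau}\big(\tau\, x_i(\tau)_-\big)\right)_-\right] d\tau .$$ Then, for all $s>0$, $$\limsup_{\varepsilon\to0^+}\ \mathrm{Lasso}\Big(\overline{x}^\varepsilon(s),\frac1s\Big) \ \le\ \mathrm{Lasso}_*\Big(\frac1s\Big) + C\left[\frac{(1+s)^{1/2}}{s}\, z^{\downarrow}(s)^{1/2} + \frac{1+s}{s^2}\, z^{\downarrow}(s)\right].$$ -/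

import Mathlib

open Filter Topology

namespace DLN

noncomputable section

/-- The quadratic loss `ℓ(x) = ½⟨x, M x⟩ - ⟨r, x⟩` on `ℝ^d`. -/
def loss {d : ℕ} (M : Matrix (Fin d) (Fin d) ℝ) (r x : EuclideanSpace ℝ (Fin d)) : ℝ :=
  (1 / 2) * inner ℝ x (Matrix.toEuclideanLin M x) - inner ℝ r x

/-- The lasso objective `Lasso(x, lam) = ℓ(x) + lam ‖x‖₁`. -/
def lasso {d : ℕ} (M : Matrix (Fin d) (Fin d) ℝ) (r x : EuclideanSpace ℝ (Fin d))
    (lam : ℝ) : ℝ :=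
  loss M r x + lam * ∑ i, |x i|

/-- The minimum value `Lasso_*(lam)` of the lasso objective over `ℝ^d`. -/
def lassoMin {d : ℕ} (M : Matrix (Fin d) (Fin d) ℝ) (r : EuclideanSpace ℝ (Fin d))
    (lam : ℝ) : ℝ :=
  ⨅ z : EuclideanSpace ℝ (Fin d), lasso M r z lam

/-- `x` selects, for every `s > 0`, a minimizer of `Lasso(·, 1/s)` over `ℝ^d`. -/
def IsLassoPath {d : ℕ} (M : Matrix (Fin d) (Fin d) ℝ) (r : EuclideanSpace ℝ (Fin d))
    (x : ℝ → EuclideanSpace ℝ (Fin d)) : Prop :=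
  ∀ s : ℝ, 0 < s → ∀ z : EuclideanSpace ℝ (Fin d), lasso M r (x s) (1 / s) ≤ lasso M r z (1 / s)

/-- The component-wise product `u ∘ v`. -/
def hadamard {d : ℕ} (u v : EuclideanSpace ℝ (Fin d)) : EuclideanSpace ℝ (Fin d) :=
  WithLp.toLp 2 fun i => u i * v i

/-- `(u, v)` solves on `[0, ∞)` the gradient flow
`du/dt = -∇_u (ℓ(u ∘ v))`, `dv/dt = -∇_v (ℓ(u ∘ v))`, starting from `(u₀, v₀)`
(at `t = 0` the derivative is the right derivative). -/
structure IsGradientFlow {d : ℕ} (M : Matrix (Fin d) (Fin d) ℝ)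
    (r u₀ v₀ : EuclideanSpace ℝ (Fin d)) (u v : ℝ → EuclideanSpace ℝ (Fin d)) : Prop where
  init_u : u 0 = u₀
  init_v : v 0 = v₀
  deriv_u : ∀ t : ℝ, 0 ≤ t →
    HasDerivWithinAt u (-gradient (fun a => loss M r (hadamard a (v t))) (u t)) (Set.Ici 0) t
  deriv_v : ∀ t : ℝ, 0 ≤ t →
    HasDerivWithinAt v (-gradient (fun b => loss M r (hadamard (u t) b)) (v t)) (Set.Ici 0) t

/-- The running average `(1/t) ∫₀ᵗ u(τ) ∘ v(τ) dτ` of the effective parameter. -/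
def avgIterate {d : ℕ} (u v : ℝ → EuclideanSpace ℝ (Fin d)) (t : ℝ) :
    EuclideanSpace ℝ (Fin d) :=
  (1 / t) • ∫ τ in (0 : ℝ)..t, hadamard (u τ) (v τ)

/-- The original time `t = (log(1/ε) / 2) s` corresponding to the rescaled time `s`. -/
def originalTime (ε s : ℝ) : ℝ := Real.log (1 / ε) / 2 * s

/-- `z↓(s)`: the total decrease on `[0, s]` of the functions `τ ↦ τ x_i(τ)₊` and
`τ ↦ τ x_i(τ)₋`, summed over the coordinates. -/
def zDown {d : ℕ} (x : ℝ → EuclideanSpace ℝ (Fin d)) (s : ℝ) : ℝ :=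
  ∑ i, ∫ τ in (0 : ℝ)..s,
    ((deriv (fun y : ℝ => y * (x y i)⁺) τ)⁻ + (deriv (fun y : ℝ => y * (x y i)⁻) τ)⁻)

end

end DLN

/-! Why the bound holds. Put `L = log (1/ε)` and rescale time by `t = L s / 2`. The integrated
product `w(s)`, which equals `s` times the average iterate, solves a closed equation: with the dual
variable `θ = s r - M w`, each coordinate obeys `w' = a e^{-L(1-θ)} - b e^{-L(1+θ)}`, where `a =
(β+γ)²/4` and `b = (β-γ)²/4`. As `L → ∞` this approximates complementary slackness: a coordinate
moves only where `|θ|` is near 1. The lasso path, written as `z = s x = p - n`, satisfies exact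
slackness.

An energy estimate shows that `θ` exceeds `[-1, 1]` by at most `O(1/L)`
(`IsRescaledFlow.abs_dual_le`). The derivative of `|w - z|_M² / 2` pairs `w' - z'` with the
difference of the two dual variables. The slackness relations make this nonpositive up to `O(1/L)`,
except where `p` or `n` decreases, so that `|w - z|_M² ≤ 4 z↓ + O(1/L)`
(`IsRescaledFlow.energy_le`).

The lasso objectives of `w` and `z`, multiplied by `s²`, grow at rates that differ by at most `⟨r, z
- w⟩ + O(1/L)`. Since `r = M y`, Cauchy-Schwarz for `M` bounds this by `|y|_M |w - z|_M`
(`IsRescaledFlow.objective_le`). Integrating over `[0, s]` and dividing by `s²` leaves an excess of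
at most `2 |y|_M √z↓ / s` in the limit, which is stronger than the stated bound. -/

namespace DLN

open Set MeasureTheory Matrix

/-! ### The semi-inner product defined by `M`. -/

section QuadraticForm

variable {d : ℕ} {M : Matrix (Fin d) (Fin d) ℝ}

lemma dotProduct_mulVec_comm (hM : M.PosSemidef) (x y : Fin d → ℝ) :
    x ⬝ᵥ M *ᵥ y = y ⬝ᵥ M *ᵥ x := by
  have h : Mᵀ = M := by simpa using hM.1.eq
  rw [dotProduct_mulVec, ← mulVec_transpose, h, dotProduct_comm]

lemma dotProduct_mulVec_self_nonneg (hM : M.PosSemidef) (x : Fin d → ℝ) :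
    0 ≤ x ⬝ᵥ M *ᵥ x := by
  simpa using hM.dotProduct_mulVec_nonneg x

lemma two_mul_dotProduct_mulVec_le (hM : M.PosSemidef) (x y : Fin d → ℝ) :
    2 * (x ⬝ᵥ M *ᵥ y) ≤ x ⬝ᵥ M *ᵥ x + y ⬝ᵥ M *ᵥ y := by
  have h := dotProduct_mulVec_self_nonneg hM (x - y)
  simp only [mulVec_sub, dotProduct_sub, sub_dotProduct] at h
  linarith [dotProduct_mulVec_comm hM x y]

lemma dotProduct_mulVec_le_sqrt (hM : M.PosSemidef) (x y : Fin d → ℝ) :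
    x ⬝ᵥ M *ᵥ y ≤ √(x ⬝ᵥ M *ᵥ x) * √(y ⬝ᵥ M *ᵥ y) := by
  have h := (Matrix.toBilin' M).apply_mul_apply_le_of_forall_zero_le
    (fun z => by simpa [Matrix.toBilin'_apply'] using dotProduct_mulVec_self_nonneg hM z) x y
  simp only [Matrix.toBilin'_apply'] at h
  rw [dotProduct_mulVec_comm hM y x] at h
  rw [← Real.sqrt_mul (dotProduct_mulVec_self_nonneg hM x)]
  exact Real.le_sqrt_of_sq_le (by rw [sq]; exact h)

lemma hasDerivAt_dotProduct_mulVec {f g : ℝ → Fin d → ℝ} {f' g' : Fin d → ℝ} {t : ℝ}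
    (hf : HasDerivAt f f' t) (hg : HasDerivAt g g' t) :
    HasDerivAt (fun τ => f τ ⬝ᵥ M *ᵥ g τ) (f' ⬝ᵥ M *ᵥ g t + f t ⬝ᵥ M *ᵥ g') t := by
  rw [hasDerivAt_pi] at hf hg
  have : HasDerivAt (fun τ => ∑ i, f τ i * ∑ j, M i j * g τ j)
      (∑ i, (f' i * ∑ j, M i j * g t j + f t i * ∑ j, M i j * g' j)) t :=
    HasDerivAt.fun_sum fun i _ =>
      (hf i).mul (HasDerivAt.fun_sum fun j _ => (hg j).const_mul _)
  simpa only [dotProduct, mulVec, Finset.sum_add_distrib] using this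

lemma hasDerivAt_dotProduct_mulVec_self (hM : M.PosSemidef) {f : ℝ → Fin d → ℝ}
    {f' : Fin d → ℝ} {t : ℝ} (hf : HasDerivAt f f' t) :
    HasDerivAt (fun τ => f τ ⬝ᵥ M *ᵥ f τ) (2 * (f' ⬝ᵥ M *ᵥ f t)) t :=
  (hasDerivAt_dotProduct_mulVec hf hf).congr_deriv (by
    rw [dotProduct_mulVec_comm hM (f t) f']; ring)

lemma hasDerivAt_const_dotProduct (c : Fin d → ℝ) {f : ℝ → Fin d → ℝ}
    {f' : Fin d → ℝ} {t : ℝ} (hf : HasDerivAt f f' t) :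
    HasDerivAt (fun τ => c ⬝ᵥ f τ) (c ⬝ᵥ f') t := by
  rw [hasDerivAt_pi] at hf
  exact HasDerivAt.fun_sum fun i _ => (hf i).const_mul (c i)

end QuadraticForm

/-! ### Absolutely continuous functions on intervals. -/

section AbsolutelyContinuous

lemma absolutelyContinuousOnInterval_const (c a b : ℝ) :
    AbsolutelyContinuousOnInterval (fun _ : ℝ => c) a b :=
  (contDiff_const.contDiffOn (n := 1)).absolutelyContinuousOnInterval

lemma absolutelyContinuousOnInterval_id (a b : ℝ) :
    AbsolutelyContinuousOnInterval (fun τ : ℝ => τ) a b :=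
  (contDiff_id.contDiffOn (n := 1)).absolutelyContinuousOnInterval

lemma absolutelyContinuousOnInterval_sum {ι : Type*} (S : Finset ι) {f : ι → ℝ → ℝ} {a b : ℝ}
    (h : ∀ i ∈ S, AbsolutelyContinuousOnInterval (f i) a b) :
    AbsolutelyContinuousOnInterval (fun τ => ∑ i ∈ S, f i τ) a b := by
  classical
  induction S using Finset.induction_on with
  | empty => simpa using absolutelyContinuousOnInterval_const 0 a b
  | insert i S hi ih =>
    simp only [Finset.sum_insert hi]
    exact (h i (Finset.mem_insert_self i S)).fun_add
      (ih fun j hj => h j (Finset.mem_insert_of_mem hj))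

lemma absolutelyContinuousOnInterval_comp_lipschitz {X Y : Type*} [PseudoMetricSpace X]
    [PseudoMetricSpace Y] {K : NNReal} {φ : X → Y} (hφ : LipschitzWith K φ) {f : ℝ → X} {a b : ℝ}
    (hf : AbsolutelyContinuousOnInterval f a b) :
    AbsolutelyContinuousOnInterval (fun τ => φ (f τ)) a b := by
  unfold AbsolutelyContinuousOnInterval at hf ⊢
  refine squeeze_zero (fun _ => Finset.sum_nonneg fun _ _ => dist_nonneg) (fun E => ?_)
    (by simpa using hf.const_mul (K : ℝ))
  rw [Finset.mul_sum]
  exact Finset.sum_le_sum fun i _ => hφ.dist_le_mul _ _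

lemma absolutelyContinuousOnInterval_dotProduct {d : ℕ} {f g : ℝ → Fin d → ℝ} {a b : ℝ}
    (hf : ∀ i, AbsolutelyContinuousOnInterval (fun τ => f τ i) a b)
    (hg : ∀ i, AbsolutelyContinuousOnInterval (fun τ => g τ i) a b) :
    AbsolutelyContinuousOnInterval (fun τ => f τ ⬝ᵥ g τ) a b :=
  by
  simp only [dotProduct]
  exact absolutelyContinuousOnInterval_sum _ fun i _ => (hf i).fun_mul (hg i)

lemma absolutelyContinuousOnInterval_mulVec {d : ℕ} (M : Matrix (Fin d) (Fin d) ℝ)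
    {f : ℝ → Fin d → ℝ} {a b : ℝ}
    (hf : ∀ i, AbsolutelyContinuousOnInterval (fun τ => f τ i) a b) (i : Fin d) :
    AbsolutelyContinuousOnInterval (fun τ => (M *ᵥ f τ) i) a b :=
  by
  simp only [mulVec, dotProduct]
  exact absolutelyContinuousOnInterval_sum _ fun j _ => (hf j).const_mul (M i j)

/-- A function that is absolutely continuous away from `0`, has a limit at `0` and whose derivative
is bounded above by an integrable function grows at most by the integral of the bound. -/
lemma sub_le_integral_of_absolutelyContinuous {f g : ℝ → ℝ} {f₀ b : ℝ} (hb : 0 < b)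
    (hac : ∀ a, 0 < a → a ≤ b → AbsolutelyContinuousOnInterval f a b)
    (hlim : Tendsto f (𝓝[>] 0) (𝓝 f₀)) (hg : IntervalIntegrable g volume 0 b)
    (hfg : ∀ᵐ τ, τ ∈ Ioo 0 b → ∃ f', HasDerivAt f f' τ ∧ f' ≤ g τ) :
    f b - f₀ ≤ ∫ τ in (0 : ℝ)..b, g τ := by
  have key : ∀ a ∈ Ioo 0 b, f b - f a ≤ (∫ τ in (0 : ℝ)..b, g τ) - ∫ τ in (0 : ℝ)..a, g τ := by
    intro a ha
    have hsub : uIcc 0 a ⊆ uIcc 0 b := by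
      rw [uIcc_of_le ha.1.le, uIcc_of_le hb.le]; exact Icc_subset_Icc_right ha.2.le
    have hsub' : uIcc a b ⊆ uIcc 0 b := by
      rw [uIcc_of_le ha.2.le, uIcc_of_le hb.le]; exact Icc_subset_Icc_left ha.1.le
    rw [intervalIntegral.integral_interval_sub_left hg (hg.mono_set hsub),
      ← (hac a ha.1 ha.2.le).integral_deriv_eq_sub]
    refine intervalIntegral.integral_mono_ae_restrict ha.2.le
      (hac a ha.1 ha.2.le).intervalIntegrable_deriv (hg.mono_set hsub') ?_
    rw [EventuallyLE, ae_restrict_iff' measurableSet_Icc]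
    -- The derivative bound is assumed on the open interval only, so the null set `{b}` is
    -- discarded.
    filter_upwards [hfg, (Set.finite_singleton b).countable.ae_notMem volume] with τ hτ hτb hmem
    obtain ⟨f', hf', hle⟩ := hτ ⟨ha.1.trans_le hmem.1, lt_of_le_of_ne hmem.2 hτb⟩
    rwa [hf'.deriv]
  have hint : Tendsto (fun a => ∫ τ in (0 : ℝ)..a, g τ) (𝓝[>] 0) (𝓝 0) := by
    have hc := intervalIntegral.continuousOn_primitive_interval
      (μ := volume) (f := g) (a := 0) (b := b)
      ((intervalIntegrable_iff_integrableOn_Icc_of_le hb.le).1 hg |>.mono_set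
        (by rw [uIcc_of_le hb.le]))
    have h0 := (hc 0 left_mem_uIcc).tendsto.mono_left (nhdsWithin_le_of_mem (by
      rw [uIcc_of_le hb.le]; exact Icc_mem_nhdsGT hb))
    rwa [intervalIntegral.integral_same] at h0
  have h1 : Tendsto (fun a => f b - f a) (𝓝[>] 0) (𝓝 (f b - f₀)) := hlim.const_sub _
  have h2 := hint.const_sub (∫ τ in (0 : ℝ)..b, g τ)
  rw [sub_zero] at h2
  exact le_of_tendsto_of_tendsto h1 h2
    (by filter_upwards [Ioo_mem_nhdsGT hb] with a ha using key a ha)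

end AbsolutelyContinuous

/-! ### First-order optimality conditions of the lasso. -/

section Optimality

variable {d : ℕ} {M : Matrix (Fin d) (Fin d) ℝ} {r : EuclideanSpace ℝ (Fin d)}

lemma loss_eq (M : Matrix (Fin d) (Fin d) ℝ) (r x : EuclideanSpace ℝ (Fin d)) :
    loss M r x = (1 / 2) * (x.ofLp ⬝ᵥ M *ᵥ x.ofLp) - r.ofLp ⬝ᵥ x.ofLp := by
  simp [loss, EuclideanSpace.inner_eq_star_dotProduct, dotProduct_comm]

lemma lasso_add_single (hM : M.PosSemidef) (x : EuclideanSpace ℝ (Fin d)) (lam : ℝ) (i : Fin d)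
    (h : ℝ) :
    lasso M r (x + EuclideanSpace.single i h) lam = lasso M r x lam
      - h * (r i - (M *ᵥ x.ofLp) i) + h ^ 2 / 2 * M i i + lam * (|x i + h| - |x i|) := by
  have hs : ∑ j, |(x + EuclideanSpace.single i h) j| = ∑ j, |x j| + (|x i + h| - |x i|) := by
    rw [← sub_eq_iff_eq_add', ← Finset.sum_sub_distrib,
      Finset.sum_eq_single i (fun j _ hj => by simp [hj]) (by simp)]
    simp
  rw [lasso, lasso, loss_eq, loss_eq, hs]
  have e : (x + EuclideanSpace.single i h).ofLp = x.ofLp + Pi.single i h := by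
    ext j; simp [Pi.single_apply]
  rw [e]
  have c := dotProduct_mulVec_comm hM x.ofLp (Pi.single i h)
  simp only [mulVec_add, dotProduct_add, add_dotProduct, c]
  simp only [single_dotProduct, mulVec_single]
  simp
  ring

/-- First-order optimality condition of the lasso along a coordinate. -/
lemma lasso_optimality (hM : M.PosSemidef) {x : EuclideanSpace ℝ (Fin d)} {lam : ℝ} (hl : 0 ≤ lam)
    (hx : ∀ z, lasso M r x lam ≤ lasso M r z lam) (i : Fin d) :
    |r i - (M *ᵥ x.ofLp) i| ≤ lam ∧ (0 < x i → r i - (M *ᵥ x.ofLp) i = lam) ∧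
      (x i < 0 → r i - (M *ᵥ x.ofLp) i = -lam) := by
  set g := r i - (M *ᵥ x.ofLp) i with hg
  have key : ∀ h, h * g ≤ h ^ 2 / 2 * M i i + lam * (|x i + h| - |x i|) := by
    intro h
    have := hx (x + EuclideanSpace.single i h)
    rw [lasso_add_single hM] at this
    linarith
  have hlim : Tendsto (fun h : ℝ => h / 2 * M i i) (𝓝[>] 0) (𝓝 0) := by
    have : Continuous fun h : ℝ => h / 2 * M i i := by fun_prop
    simpa using (this.tendsto 0).mono_left nhdsWithin_le_nhds
  -- Dividing by `h` and letting `h → 0⁺` removes the quadratic term; each one-sided optimality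
  -- inequality is an instance.
  have small : ∀ c : ℝ, (∀ᶠ h in 𝓝[>] (0 : ℝ), h * c ≤ h ^ 2 / 2 * M i i) → c ≤ 0 := by
    intro c hc
    refine ge_of_tendsto hlim ?_
    filter_upwards [hc, self_mem_nhdsWithin] with h hh (hpos : 0 < h)
    have : h * c ≤ h * (h / 2 * M i i) := by rw [← mul_assoc]; convert hh using 1; ring
    exact le_of_mul_le_mul_left this hpos
  rcases lt_trichotomy (x i) 0 with hneg | hzero | hpos
  · have e : g = -lam := by
      have h1 := small (g + lam) (by
        filter_upwards [Ioo_mem_nhdsGT (neg_pos.2 hneg)] with h hh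
        have := key h
        rw [abs_of_neg hneg, abs_of_neg (by linarith [hh.2])] at this
        nlinarith)
      have h2 := small (-(g + lam)) (by
        filter_upwards [self_mem_nhdsWithin] with h (hh : 0 < h)
        have := key (-h)
        rw [abs_of_neg hneg, abs_of_neg (by linarith)] at this
        nlinarith)
      linarith
    exact ⟨by rw [e, abs_neg, abs_of_nonneg hl], fun h => absurd h hneg.not_gt, fun _ => e⟩
  · have h1 := small (g - lam) (by
      filter_upwards [self_mem_nhdsWithin] with h (hh : 0 < h)
      have := key h
      simp only [hzero, zero_add, abs_zero, sub_zero, abs_of_pos hh] at this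
      nlinarith)
    have h2 := small (-g - lam) (by
      filter_upwards [self_mem_nhdsWithin] with h (hh : 0 < h)
      have := key (-h)
      simp only [hzero, zero_add, abs_zero, sub_zero, abs_neg, abs_of_pos hh] at this
      nlinarith)
    exact ⟨abs_le.2 ⟨by linarith, by linarith⟩, fun h => absurd h (by simp [hzero]),
      fun h => absurd h (by simp [hzero])⟩
  · have e : g = lam := by
      have h1 := small (g - lam) (by
        filter_upwards [self_mem_nhdsWithin] with h (hh : 0 < h)
        have := key h
        rw [abs_of_pos hpos, abs_of_pos (by linarith)] at this
        nlinarith)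
      have h2 := small (-(g - lam)) (by
        filter_upwards [Ioo_mem_nhdsGT hpos] with h hh
        have := key (-h)
        rw [abs_of_pos hpos, abs_of_pos (by linarith [hh.2])] at this
        nlinarith)
      linarith
    exact ⟨by rw [e, abs_of_nonneg hl], fun _ => e, fun h => absurd h hpos.not_gt⟩

end Optimality

noncomputable section

/-! ### One-dimensional estimates on the exponential gains. -/

section ScalarBounds

/-- The exponential response `c e^{-L (1 - h)}` of a coordinate to the dual variable `h`. -/
def gain (L c h : ℝ) : ℝ := c * Real.exp (-(L * (1 - h)))

lemma gain_nonneg (L : ℝ) {c : ℝ} (hc : 0 ≤ c) (h : ℝ) : 0 ≤ gain L c h :=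
  mul_nonneg hc (Real.exp_pos _).le

/-- This is `q e^{-q} ≤ 1` with `q = L (1 - h)`. It is approximate complementary slackness for the
flow, and the source of the `1 / L` errors coming from the gains. -/
lemma gain_mul_one_sub_le {L c : ℝ} (hL : 0 < L) (hc : 0 ≤ c) (h : ℝ) :
    gain L c h * (1 - h) ≤ c / L := by
  rw [le_div_iff₀ hL]
  have h1 : L * (1 - h) * Real.exp (-(L * (1 - h))) ≤ 1 := by
    rw [Real.exp_neg, ← div_eq_mul_inv, div_le_one (Real.exp_pos _)]
    linarith [Real.add_one_le_exp (L * (1 - h))]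
  calc gain L c h * (1 - h) * L = c * (L * (1 - h) * Real.exp (-(L * (1 - h)))) := by
        unfold gain; ring
    _ ≤ c * 1 := mul_le_mul_of_nonneg_left h1 hc
    _ = c := mul_one c

lemma gain_neg_mul_le {L c : ℝ} (hL : 1 ≤ L) (hc : 0 ≤ c) (h : ℝ) : gain L c (-h) * h ≤ c := by
  have h1 := gain_mul_one_sub_le (by linarith : 0 < L) hc (-h)
  have h2 := gain_nonneg L hc (-h)
  have h3 : c / L ≤ c := div_le_self hc hL
  nlinarith

lemma gain_mul_self_le {L b : ℝ} (a : ℝ) (hL : 1 ≤ L) (hb : 0 ≤ b) (h : ℝ) :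
    gain L a h * h ≤ h * (gain L a h - gain L b (-h)) + b := by
  nlinarith [gain_neg_mul_le hL hb h]

/-- Only the gain whose direction opposes the sign of `h` contributes negatively, and its
contribution is bounded uniformly in `L`. -/
lemma neg_add_le_mul_gain_sub {L a b : ℝ} (hL : 1 ≤ L) (ha : 0 ≤ a) (hb : 0 ≤ b) (h : ℝ) :
    -(a + b) ≤ h * (gain L a h - gain L b (-h)) := by
  rcases le_total 0 h with hh | hh
  · nlinarith [gain_neg_mul_le hL hb h, mul_nonneg (gain_nonneg L ha h) hh]
  · have h1 := gain_neg_mul_le hL ha (-h)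
    rw [neg_neg] at h1
    nlinarith [mul_nonneg (gain_nonneg L hb (-h)) (neg_nonneg.2 hh)]

/-- For `h ≥ 1` the gain is at most `S + b`, while the tangent line of the exponential gives at
least `a L (h - 1)`. -/
lemma le_one_add_of_mul_gain_sub_le {L a b S : ℝ} (hL : 1 ≤ L) (ha : 0 < a) (hb : 0 ≤ b)
    (hS : 0 ≤ S) {h : ℝ} (hh : h * (gain L a h - gain L b (-h)) ≤ S) :
    h ≤ 1 + (S + b) / a / L := by
  have hL0 : 0 < L := by linarith
  rcases le_total h 1 with h1 | h1
  · have : 0 ≤ (S + b) / a / L := by positivity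
    linarith
  · have h2 := gain_mul_self_le a hL hb h
    have h3 := gain_nonneg L ha.le h
    have h4 : gain L a h ≤ S + b := by nlinarith
    have h5 : a * (L * (h - 1)) ≤ gain L a h := by
      refine mul_le_mul_of_nonneg_left ?_ ha.le
      have := Real.add_one_le_exp (-(L * (1 - h)))
      linarith
    have : h - 1 ≤ (S + b) / a / L := by
      rw [div_div, le_div_iff₀ (by positivity)]
      nlinarith
    linarith

lemma hasDerivAt_gain (L c : ℝ) {h : ℝ → ℝ} {h' t : ℝ} (hh : HasDerivAt h h' t) :
    HasDerivAt (fun τ => gain L c (h τ)) (gain L c (h t) * (L * h')) t := by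
  have := (((hh.const_sub 1).const_mul L).neg.exp).const_mul c
  refine this.congr_deriv ?_
  simp only [gain, Pi.neg_apply]; ring

end ScalarBounds

/-! ### The rescaled flow and the bound on its dual variable. -/

variable {d : ℕ}

/-- The velocity of the rescaled flow as a function of the dual variable. -/
def velocity (L : ℝ) (a b θ : Fin d → ℝ) : Fin d → ℝ :=
  fun i => gain L (a i) (θ i) - gain L (b i) (-θ i)

/-- The dual variable `s r - M w` attached to the integrated trajectory `w` at time `s`. -/
def dual (M : Matrix (Fin d) (Fin d) ℝ) (r : Fin d → ℝ) (w : ℝ → Fin d → ℝ) (s : ℝ) :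
    Fin d → ℝ := s • r - M *ᵥ w s

/-- The integrated trajectory of the gradient flow in rescaled time. -/
structure IsRescaledFlow (M : Matrix (Fin d) (Fin d) ℝ) (r a b : Fin d → ℝ) (L : ℝ)
    (w : ℝ → Fin d → ℝ) : Prop where
  zero : w 0 = 0
  continuous : Continuous w
  hasDerivAt : ∀ s, 0 < s → HasDerivAt w (velocity L a b (dual M r w s)) s

variable {M : Matrix (Fin d) (Fin d) ℝ} {r a b y : Fin d → ℝ} {L : ℝ} {w : ℝ → Fin d → ℝ}

lemma hasDerivAt_dual {w' : Fin d → ℝ} {s : ℝ} (hw : HasDerivAt w w' s) :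
    HasDerivAt (dual M r w) (r - M *ᵥ w') s := by
  have h1 : HasDerivAt (fun τ : ℝ => τ • r) r s := by
    simpa using (hasDerivAt_id s).smul_const r
  refine h1.sub ?_
  rw [hasDerivAt_pi] at hw ⊢
  intro i
  simp only [mulVec, dotProduct]
  exact HasDerivAt.fun_sum fun j _ => (hw j).const_mul (M i j)

lemma hasDerivAt_velocity {θ : ℝ → Fin d → ℝ} {θ' : Fin d → ℝ} {s : ℝ} (hθ : HasDerivAt θ θ' s) :
    HasDerivAt (fun τ => velocity L a b (θ τ))
      (fun i => (gain L (a i) (θ s i) + gain L (b i) (-θ s i)) * (L * θ' i)) s := by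
  rw [hasDerivAt_pi] at hθ ⊢
  intro i
  refine ((hasDerivAt_gain L (a i) (hθ i)).sub (hasDerivAt_gain L (b i) (hθ i).neg)).congr_deriv ?_
  simp only [Pi.neg_apply]; ring

lemma continuous_dual (hw : Continuous w) : Continuous (dual M r w) := by
  unfold dual
  fun_prop

lemma continuous_velocity {θ : ℝ → Fin d → ℝ} (hθ : Continuous θ) :
    Continuous fun τ => velocity L a b (θ τ) := by
  unfold velocity gain
  fun_prop

/-- The energy is twice the excess loss of the velocity `X` over its minimum at `y`. It decreases
because its derivative is `-2L` times a sum of squares of `(M (X - y))_i` weighted by the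
nonnegative gains. -/
lemma IsRescaledFlow.velocity_energy_le (hM : M.PosSemidef) (hy : M *ᵥ y = r)
    (ha : ∀ i, 0 ≤ a i) (hb : ∀ i, 0 ≤ b i) (hL : 0 ≤ L) (hw : IsRescaledFlow M r a b L w)
    {s : ℝ} (hs : 0 ≤ s) :
    (velocity L a b (dual M r w s) - y) ⬝ᵥ M *ᵥ (velocity L a b (dual M r w s) - y) ≤
      (velocity L a b 0 - y) ⬝ᵥ M *ᵥ (velocity L a b 0 - y) := by
  set X : ℝ → Fin d → ℝ := fun τ => velocity L a b (dual M r w τ) - y with hX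
  have hXc : Continuous X := (continuous_velocity (continuous_dual hw.continuous)).sub
    continuous_const
  have hder : ∀ τ, 0 < τ → HasDerivAt (fun τ => X τ ⬝ᵥ M *ᵥ X τ) (2 *
      ((fun i => (gain L (a i) (dual M r w τ i) + gain L (b i) (-dual M r w τ i)) *
        (L * (-(M *ᵥ X τ) i))) ⬝ᵥ M *ᵥ X τ)) τ := by
    intro τ hτ
    refine hasDerivAt_dotProduct_mulVec_self hM ?_
    refine ((hasDerivAt_velocity (hasDerivAt_dual (hw.hasDerivAt τ hτ))).sub_const y).congr_deriv ?_
    funext i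
    simp [hX, mulVec_sub, hy]
  have hanti : AntitoneOn (fun τ => X τ ⬝ᵥ M *ᵥ X τ) (Ici 0) := by
    refine antitoneOn_of_deriv_nonpos (convex_Ici 0)
      (Continuous.continuousOn (by fun_prop)) ?_ ?_
    · intro τ hτ
      rw [interior_Ici] at hτ
      exact (hder τ hτ).differentiableAt.differentiableWithinAt
    · intro τ hτ
      rw [interior_Ici] at hτ
      rw [(hder τ hτ).deriv]
      refine mul_nonpos_of_nonneg_of_nonpos two_pos.le (Finset.sum_nonpos fun i _ => ?_)
      have h1 := add_nonneg (gain_nonneg L (ha i) (dual M r w τ i))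
        (gain_nonneg L (hb i) (-dual M r w τ i))
      have h2 := mul_nonneg (mul_nonneg h1 hL) (mul_self_nonneg ((M *ᵥ X τ) i))
      linarith
  have := hanti (self_mem_Ici) hs hs
  have h0 : dual M r w 0 = 0 := by simp [dual, hw.zero]
  simpa [hX, h0] using this

/-- Grönwall's argument: `φ = s y - w` has `φ' = y - X` of energy at most `K₀`, so `(|φ|²)' ≤ |φ|² +
K₀`. The dual variable is `M φ`. -/
lemma IsRescaledFlow.dual_energy_le (hM : M.PosSemidef) (hy : M *ᵥ y = r)
    (ha : ∀ i, 0 ≤ a i) (hb : ∀ i, 0 ≤ b i) (hL : 0 ≤ L) (hw : IsRescaledFlow M r a b L w)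
    {K₀ : ℝ} (hK₀ : (velocity L a b 0 - y) ⬝ᵥ M *ᵥ (velocity L a b 0 - y) ≤ K₀)
    {s : ℝ} (hs : 0 ≤ s) :
    (s • y - w s) ⬝ᵥ M *ᵥ (s • y - w s) ≤ K₀ * Real.exp s := by
  set φ : ℝ → Fin d → ℝ := fun τ => τ • y - w τ with hφ
  have hwc := hw.continuous
  have hφc : Continuous φ := by fun_prop
  have hder : ∀ τ, 0 < τ → HasDerivAt (fun τ => Real.exp (-τ) * (φ τ ⬝ᵥ M *ᵥ φ τ + K₀))
      (Real.exp (-τ) * (2 * ((y - velocity L a b (dual M r w τ)) ⬝ᵥ M *ᵥ φ τ)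
        - (φ τ ⬝ᵥ M *ᵥ φ τ + K₀))) τ := by
    intro τ hτ
    have h1 : HasDerivAt φ (y - velocity L a b (dual M r w τ)) τ := by
      have h1 : HasDerivAt (fun τ : ℝ => τ • y) y τ := by
        simpa using (hasDerivAt_id τ).smul_const y
      exact h1.sub (hw.hasDerivAt τ hτ)
    have h2 := ((hasDerivAt_neg τ).exp).mul
      ((hasDerivAt_dotProduct_mulVec_self hM h1).add_const K₀)
    refine h2.congr_deriv ?_
    ring
  have hanti : AntitoneOn (fun τ => Real.exp (-τ) * (φ τ ⬝ᵥ M *ᵥ φ τ + K₀)) (Ici 0) := by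
    refine antitoneOn_of_deriv_nonpos (convex_Ici 0)
      (Continuous.continuousOn (by fun_prop)) ?_ ?_
    · intro τ hτ
      rw [interior_Ici] at hτ
      exact (hder τ hτ).differentiableAt.differentiableWithinAt
    · intro τ hτ
      rw [interior_Ici] at hτ
      rw [(hder τ hτ).deriv]
      refine mul_nonpos_of_nonneg_of_nonpos (Real.exp_pos _).le ?_
      have h1 := two_mul_dotProduct_mulVec_le hM (y - velocity L a b (dual M r w τ)) (φ τ)
      have h2 := hw.velocity_energy_le hM hy ha hb hL (le_of_lt hτ)
      have h3 : (y - velocity L a b (dual M r w τ)) ⬝ᵥ M *ᵥ (y - velocity L a b (dual M r w τ)) =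
          (velocity L a b (dual M r w τ) - y) ⬝ᵥ M *ᵥ (velocity L a b (dual M r w τ) - y) := by
        rw [← neg_sub y, mulVec_neg, neg_dotProduct_neg]
      linarith
  have h := hanti self_mem_Ici hs hs
  have h0 : φ 0 = 0 := by simp [hφ, hw.zero]
  simp only [h0, neg_zero, Real.exp_zero, zero_dotProduct, zero_add, one_mul] at h
  have hK : 0 ≤ K₀ := (dotProduct_mulVec_self_nonneg hM _).trans hK₀
  rw [Real.exp_neg, inv_mul_le_iff₀ (Real.exp_pos s)] at h
  change φ s ⬝ᵥ M *ᵥ φ s ≤ _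
  linarith

/-- The dual variable of the rescaled flow leaves `[-1, 1]` by at most `O(1 / L)`. -/
lemma IsRescaledFlow.abs_dual_le (hM : M.PosSemidef) (hy : M *ᵥ y = r)
    (ha : ∀ i, 0 < a i) (hb : ∀ i, 0 < b i) (T : ℝ) (K₀ : ℝ) :
    ∃ K, 0 ≤ K ∧ ∀ (L : ℝ) (w : ℝ → Fin d → ℝ), 1 ≤ L → IsRescaledFlow M r a b L w →
      (velocity L a b 0 - y) ⬝ᵥ M *ᵥ (velocity L a b 0 - y) ≤ K₀ →
      ∀ s ∈ Icc 0 T, ∀ i, |dual M r w s i| ≤ 1 + K / L := by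
  -- The first three terms bound `⟨θ, X⟩ = ⟨X, M φ⟩`; the last sum absorbs the negative
  -- contributions of the other coordinates, so that each single `θ i * X i` is at most `S`.
  set S : ℝ := |K₀| * Real.exp T + |K₀| + (y ⬝ᵥ M *ᵥ y) + ∑ i, (a i + b i) with hS
  have hab : ∀ i, 0 ≤ a i + b i := fun i => (add_pos (ha i) (hb i)).le
  have hS0 : 0 ≤ S := by
    have := dotProduct_mulVec_self_nonneg hM y
    have := Finset.sum_nonneg fun i (_ : i ∈ Finset.univ) => hab i
    positivity
  have hterm : ∀ i, 0 ≤ (S + b i) / a i + (S + a i) / b i := fun i => by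
    have := ha i; have := hb i; positivity
  refine ⟨∑ i, ((S + b i) / a i + (S + a i) / b i), Finset.sum_nonneg fun i _ => hterm i, ?_⟩
  intro L w hL hw hK s hs i
  have ha' := fun i => (ha i).le
  have hb' := fun i => (hb i).le
  have hL0 : 0 < L := by linarith
  set θ := dual M r w s with hθ
  set X := velocity L a b θ with hX
  have hθφ : θ = M *ᵥ (s • y - w s) := by
    rw [hθ, dual, mulVec_sub, mulVec_smul, hy]
  have hsum : ∑ j, θ j * X j ≤ S - ∑ j, (a j + b j) := by
    have e : ∑ j, θ j * X j = X ⬝ᵥ M *ᵥ (s • y - w s) := by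
      rw [← hθφ]; exact Finset.sum_congr rfl fun j _ => mul_comm _ _
    have e2 : X ⬝ᵥ M *ᵥ (s • y - w s) =
        (X - y) ⬝ᵥ M *ᵥ (s • y - w s) + y ⬝ᵥ M *ᵥ (s • y - w s) := by
      rw [← add_dotProduct, sub_add_cancel]
    have h1 := two_mul_dotProduct_mulVec_le hM (X - y) (s • y - w s)
    have h2 := two_mul_dotProduct_mulVec_le hM y (s • y - w s)
    have h3 := hw.dual_energy_le hM hy ha' hb' hL0.le hK hs.1
    have h4 := hw.velocity_energy_le hM hy ha' hb' hL0.le hs.1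
    have h5 : K₀ * Real.exp s ≤ |K₀| * Real.exp T :=
      mul_le_mul (le_abs_self _) (Real.exp_le_exp.2 hs.2) (Real.exp_pos _).le (abs_nonneg _)
    have h6 := dotProduct_mulVec_self_nonneg hM y
    have h7 := le_abs_self K₀
    have h8 := abs_nonneg K₀
    rw [e, e2, hS]
    linarith
  have hi : θ i * X i ≤ S := by
    have h1 : θ i * X i + (a i + b i) ≤ ∑ j, (θ j * X j + (a j + b j)) :=
      Finset.single_le_sum (f := fun j => θ j * X j + (a j + b j))
        (fun j _ => neg_le_iff_add_nonneg.1
          (neg_add_le_mul_gain_sub hL (ha' j) (hb' j) (θ j)))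
        (Finset.mem_univ i)
    rw [Finset.sum_add_distrib] at h1
    linarith [hab i]
  have hup := le_one_add_of_mul_gain_sub_le hL (ha i) (hb' i) hS0 hi
  have hlo := le_one_add_of_mul_gain_sub_le (h := -θ i) hL (hb i) (ha' i) hS0
    (by rw [neg_neg]; linarith [hi, show X i = gain L (a i) (θ i) - gain L (b i) (-θ i) from rfl,
          show θ i * X i = -θ i * (gain L (b i) (-θ i) - gain L (a i) (θ i)) by
            simp only [hX, velocity]; ring])
  have hK1 : (S + b i) / a i + (S + a i) / b i ≤ ∑ i, ((S + b i) / a i + (S + a i) / b i) :=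
    Finset.single_le_sum (f := fun i => (S + b i) / a i + (S + a i) / b i)
      (fun j _ => hterm j) (Finset.mem_univ i)
  have p1 : 0 ≤ (S + b i) / a i := by have := ha i; have := hb i; positivity
  have p2 : 0 ≤ (S + a i) / b i := by have := ha i; have := hb i; positivity
  have q1 := div_le_div_of_nonneg_right ((le_add_of_nonneg_right p2).trans hK1) hL0.le
  have q2 := div_le_div_of_nonneg_right ((le_add_of_nonneg_left p1).trans hK1) hL0.le
  exact abs_le.2 ⟨by linarith, by linarith⟩

end

/-! ### Distance between the flow and the lasso trajectory. -/

noncomputable section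

variable {d : ℕ}

/-- The optimality properties of the positive part `p` and negative part `n` of `s ↦ s • x s`,
where `x` is an absolutely continuous lasso path. -/
structure IsLassoTrajectory (M : Matrix (Fin d) (Fin d) ℝ) (r : Fin d → ℝ)
    (p n : ℝ → Fin d → ℝ) : Prop where
  abs_dual_le : ∀ s, 0 < s → ∀ i, |dual M r (fun τ => p τ - n τ) s i| ≤ 1
  slack_pos : ∀ s, 0 < s → ∀ i p', HasDerivAt (fun τ => p τ i) p' s →
    p' * (1 - dual M r (fun τ => p τ - n τ) s i) = 0
  slack_neg : ∀ s, 0 < s → ∀ i n', HasDerivAt (fun τ => n τ i) n' s →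
    n' * (1 + dual M r (fun τ => p τ - n τ) s i) = 0
  ac_pos : ∀ a b, 0 < a → a ≤ b → ∀ i, AbsolutelyContinuousOnInterval (fun τ => p τ i) a b
  ac_neg : ∀ a b, 0 < a → a ≤ b → ∀ i, AbsolutelyContinuousOnInterval (fun τ => n τ i) a b
  eventually_zero : ∀ᶠ s in 𝓝[>] 0, p s = 0 ∧ n s = 0

/-- Absolute continuity is available only away from 0; vanishing near 0 makes the derivative
integrable up to the origin. -/
lemma intervalIntegrable_deriv_of_eventually_zero {f : ℝ → ℝ} {T : ℝ} (hT : 0 < T)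
    (hac : ∀ a, 0 < a → a ≤ T → AbsolutelyContinuousOnInterval f a T)
    (hzero : ∀ᶠ s in 𝓝[>] 0, f s = 0) : IntervalIntegrable (deriv f) volume 0 T := by
  obtain ⟨c, hc, hcz⟩ := (mem_nhdsGT_iff_exists_Ioo_subset' hT).1 hzero
  set e := min c T with he
  have he0 : 0 < e := lt_min hc hT
  refine IntervalIntegrable.trans (b := e) ?_
    (hac e he0 (min_le_right _ _)).intervalIntegrable_deriv
  have h0 : IntervalIntegrable (fun _ : ℝ => (0 : ℝ)) volume 0 e := intervalIntegrable_const
  refine h0.congr_ae ?_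
  rw [EventuallyEq, uIoc_of_le he0.le, ae_restrict_iff' measurableSet_Ioc]
  filter_upwards [(Set.finite_singleton e).countable.ae_notMem volume] with τ hτ hmem
  have hlt : τ < c := (lt_of_le_of_ne hmem.2 hτ).trans_le (min_le_left _ _)
  have : f =ᶠ[𝓝 τ] fun _ => 0 := by
    filter_upwards [Ioo_mem_nhds hmem.1 hlt] with σ hσ using hcz hσ
  rw [this.deriv_eq, deriv_const]

variable {M : Matrix (Fin d) (Fin d) ℝ} {r a b y : Fin d → ℝ} {L : ℝ} {w p n : ℝ → Fin d → ℝ}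

namespace IsLassoTrajectory

lemma intervalIntegrable_deriv_pos (hz : IsLassoTrajectory M r p n) {T : ℝ} (hT : 0 < T)
    (i : Fin d) : IntervalIntegrable (deriv fun τ => p τ i) volume 0 T :=
  intervalIntegrable_deriv_of_eventually_zero hT (fun a ha haT => hz.ac_pos a T ha haT i)
    (hz.eventually_zero.mono fun s hs => by simp [hs.1])

lemma intervalIntegrable_deriv_neg (hz : IsLassoTrajectory M r p n) {T : ℝ} (hT : 0 < T)
    (i : Fin d) : IntervalIntegrable (deriv fun τ => n τ i) volume 0 T :=
  intervalIntegrable_deriv_of_eventually_zero hT (fun a ha haT => hz.ac_neg a T ha haT i)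
    (hz.eventually_zero.mono fun s hs => by simp [hs.2])

/-- The half-line is exhausted by the countably many intervals `[1/(k+1), k+1]`. -/
lemma ae_hasDerivAt (hz : IsLassoTrajectory M r p n) :
    ∀ᵐ τ, 0 < τ → ∀ i, HasDerivAt (fun τ => p τ i) (deriv (fun τ => p τ i) τ) τ ∧
      HasDerivAt (fun τ => n τ i) (deriv (fun τ => n τ i) τ) τ := by
  have h : ∀ k : ℕ, ∀ᵐ τ, τ ∈ uIcc (1 / ((k : ℝ) + 1)) (k + 1) → ∀ i,
      HasDerivAt (fun τ => p τ i) (deriv (fun τ => p τ i) τ) τ ∧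
      HasDerivAt (fun τ => n τ i) (deriv (fun τ => n τ i) τ) τ := by
    intro k
    have hk : (0 : ℝ) < 1 / ((k : ℝ) + 1) := by positivity
    have hk' : 1 / ((k : ℝ) + 1) ≤ (k : ℝ) + 1 := by
      rw [div_le_iff₀ (by positivity)]; nlinarith [(Nat.cast_nonneg k : (0 : ℝ) ≤ k)]
    have hp := ae_all_iff.2 fun i => (hz.ac_pos _ _ hk hk' i).ae_differentiableAt
    have hn := ae_all_iff.2 fun i => (hz.ac_neg _ _ hk hk' i).ae_differentiableAt
    filter_upwards [hp, hn] with τ h1 h2 hτ i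
    exact ⟨(h1 i hτ).hasDerivAt, (h2 i hτ).hasDerivAt⟩
  filter_upwards [ae_all_iff.2 h] with τ hτ hpos
  obtain ⟨k, hk⟩ := exists_nat_gt (max τ (1 / τ))
  have h1 : τ < k := (le_max_left _ _).trans_lt hk
  have h2 : 1 / τ < k := (le_max_right _ _).trans_lt hk
  refine hτ k (mem_uIcc_of_le ?_ (by linarith))
  rw [one_div_le (by positivity) hpos]
  linarith

end IsLassoTrajectory

lemma IsRescaledFlow.absolutelyContinuous (hw : IsRescaledFlow M r a b L w) {c e : ℝ} (hc : 0 < c)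
    (hce : c ≤ e) (i : Fin d) : AbsolutelyContinuousOnInterval (fun τ => w τ i) c e := by
  have hcont : Continuous fun τ => velocity L a b (dual M r w τ) i :=
    (continuous_apply i).comp (continuous_velocity (continuous_dual hw.continuous))
  obtain ⟨C, hC⟩ := (isCompact_Icc (a := c) (b := e)).exists_bound_of_continuousOn
    hcont.continuousOn
  have : LipschitzOnWith C.toNNReal (fun τ => w τ i) (uIcc c e) := by
    rw [uIcc_of_le hce]
    refine (convex_Icc c e).lipschitzOnWith_of_nnnorm_hasDerivWithin_le
      (f' := fun τ => velocity L a b (dual M r w τ) i)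
      (fun τ hτ => (hasDerivAt_pi.1 (hw.hasDerivAt τ (hc.trans_le hτ.1)) i).hasDerivWithinAt) ?_
    intro τ hτ
    rw [← norm_toNNReal]
    exact Real.toNNReal_le_toNNReal (hC τ hτ)
  exact this.absolutelyContinuousOnInterval

/-- This is where `z↓` enters: an increase costs only the overshoot `δ`, whereas a decrease is
multiplied by `1 - h`, which can be as large as `2 + δ`. -/
lemma neg_mul_one_sub_le {q h δ : ℝ} (h₁ : |h| ≤ 1 + δ) :
    -q * (1 - h) ≤ 2 * q⁻ + δ * |q| := by
  obtain ⟨h2, h3⟩ := abs_le.1 h₁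
  rcases le_total 0 q with hq | hq
  · rw [negPart_of_nonneg hq, abs_of_nonneg hq]; nlinarith
  · rw [negPart_of_nonpos hq, abs_of_nonpos hq]; nlinarith

/-- Writing `k - h = (1 - h) - (1 - k)`, the gain at `h` meets `1 - h`, which is small, and `-(1 -
k) ≤ 0`; for `p'` the factor `1 - k` drops out by slackness. The terms in `b` and `n'` are
symmetric. -/
lemma velocity_sub_mul_dual_sub_le {a b h k p' n' δ : ℝ} (hL : 0 < L) (ha : 0 ≤ a) (hb : 0 ≤ b)
    (hh : |h| ≤ 1 + δ) (hk : |k| ≤ 1) (hp : p' * (1 - k) = 0)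
    (hn : n' * (1 + k) = 0) :
    (gain L a h - gain L b (-h) - (p' - n')) * (k - h) ≤
      2 * (p'⁻ + n'⁻) + δ * (|p'| + |n'|) + (a + b) / L := by
  obtain ⟨k1, k2⟩ := abs_le.1 hk
  have h1 := gain_mul_one_sub_le hL ha h
  have h2 := gain_mul_one_sub_le hL hb (-h)
  have h3 := mul_nonneg (gain_nonneg L ha h) (sub_nonneg.2 k2)
  have h4 := mul_nonneg (gain_nonneg L hb (-h)) (by linarith : 0 ≤ 1 + k)
  have h5 := neg_mul_one_sub_le (q := p') hh
  have h6 := neg_mul_one_sub_le (q := n') (h := -h) (by rwa [abs_neg])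
  rw [add_div]
  linarith

/-- The squared `M`-distance between the flow and the lasso trajectory is controlled by the
decrease of the latter. -/
lemma IsRescaledFlow.energy_le (hM : M.PosSemidef) (ha : ∀ i, 0 ≤ a i) (hb : ∀ i, 0 ≤ b i)
    (hL : 0 < L) (hw : IsRescaledFlow M r a b L w) (hz : IsLassoTrajectory M r p n)
    {T K : ℝ} (hK : 0 ≤ K) (hθ : ∀ s ∈ Icc 0 T, ∀ i, |dual M r w s i| ≤ 1 + K / L)
    {s : ℝ} (hs : 0 < s) (hsT : s ≤ T) :
    (w s - (p s - n s)) ⬝ᵥ M *ᵥ (w s - (p s - n s)) ≤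
      4 * (∑ i, ∫ τ in (0 : ℝ)..T, ((deriv (fun σ => p σ i) τ)⁻ + (deriv (fun σ => n σ i) τ)⁻)) +
      2 * (K * (∑ i, ∫ τ in (0 : ℝ)..T,
        (|deriv (fun σ => p σ i) τ| + |deriv (fun σ => n σ i) τ|)) + T * ∑ i, (a i + b i)) / L := by
  have hT : 0 < T := hs.trans_le hsT
  set z : ℝ → Fin d → ℝ := fun τ => p τ - n τ with hzdef
  set g : Fin d → ℝ → ℝ := fun i τ => 2 * ((deriv (fun σ => p σ i) τ)⁻ + (deriv (fun σ => n σ i) τ)⁻)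
    + K / L * (|deriv (fun σ => p σ i) τ| + |deriv (fun σ => n σ i) τ|) + (a i + b i) / L with hg
  have negInt : ∀ {f : ℝ → ℝ}, IntervalIntegrable f volume 0 T →
      IntervalIntegrable (fun τ => (f τ)⁻) volume 0 T := by
    intro f hf
    have : (fun τ => (f τ)⁻) = fun τ => (|f τ| - f τ) / 2 := by
      funext τ
      rcases le_total 0 (f τ) with h | h
      · rw [negPart_of_nonneg h, abs_of_nonneg h]; ring
      · rw [negPart_of_nonpos h, abs_of_nonpos h]; ring
    rw [this]
    exact (hf.abs.sub hf).div_const 2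
  have hI1 : ∀ i, IntervalIntegrable (fun τ => (deriv (fun σ => p σ i) τ)⁻ +
      (deriv (fun σ => n σ i) τ)⁻) volume 0 T := fun i =>
    (negInt (hz.intervalIntegrable_deriv_pos hT i)).add
      (negInt (hz.intervalIntegrable_deriv_neg hT i))
  have hI2 : ∀ i, IntervalIntegrable (fun τ => |deriv (fun σ => p σ i) τ| +
      |deriv (fun σ => n σ i) τ|) volume 0 T := fun i =>
    (hz.intervalIntegrable_deriv_pos hT i).abs.add (hz.intervalIntegrable_deriv_neg hT i).abs
  have hI : ∀ i, IntervalIntegrable (g i) volume 0 T := fun i =>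
    (((hI1 i).const_mul 2).add ((hI2 i).const_mul (K / L))).add intervalIntegrable_const
  have hδ : 0 ≤ K / L := div_nonneg hK hL.le
  have hg0 : ∀ i τ, 0 ≤ g i τ := fun i τ => by
    have h1 := negPart_nonneg (deriv (fun σ => p σ i) τ)
    have h2 := negPart_nonneg (deriv (fun σ => n σ i) τ)
    have h3 := div_nonneg (add_nonneg (ha i) (hb i)) hL.le
    have := mul_nonneg hδ (add_nonneg (abs_nonneg (deriv (fun σ => p σ i) τ))
      (abs_nonneg (deriv (fun σ => n σ i) τ)))
    simp only [hg]
    linarith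
  have hIs : IntervalIntegrable (fun τ => ∑ i, g i τ) volume 0 T := by
    have := IntervalIntegrable.sum Finset.univ (fun i _ => hI i)
    simpa only [Finset.sum_fn] using this
  have hsub : uIcc 0 s ⊆ uIcc 0 T := by
    rw [uIcc_of_le hs.le, uIcc_of_le hT.le]; exact Icc_subset_Icc_right hsT
  have hzero : ∀ᶠ τ in 𝓝[>] 0, z τ = 0 :=
    hz.eventually_zero.mono fun τ hτ => by simp [hzdef, hτ.1, hτ.2]
  have hlim : Tendsto (fun τ => (w τ - z τ) ⬝ᵥ M *ᵥ (w τ - z τ) / 2) (𝓝[>] 0) (𝓝 0) := by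
    have hwc := hw.continuous
    have h1 : Continuous fun τ => w τ ⬝ᵥ M *ᵥ w τ / 2 := by fun_prop
    have h2 := (h1.tendsto 0).mono_left (nhdsWithin_le_nhds (s := Ioi 0))
    simp only [hw.zero, zero_dotProduct, zero_div] at h2
    refine h2.congr' ?_
    filter_upwards [hzero] with τ hτ
    rw [hτ, sub_zero]
  have hdiff := sub_le_integral_of_absolutelyContinuous (f₀ := 0) (g := fun τ => ∑ i, g i τ)
    hs (f := fun τ => (w τ - z τ) ⬝ᵥ M *ᵥ (w τ - z τ) / 2) ?_ hlim (hIs.mono_set hsub) ?_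
  · rw [sub_zero] at hdiff
    have h1 : ∫ τ in (0 : ℝ)..s, ∑ i, g i τ ≤ ∫ τ in (0 : ℝ)..T, ∑ i, g i τ :=
      intervalIntegral.integral_mono_interval le_rfl hs.le hsT
        (Eventually.of_forall fun τ => Finset.sum_nonneg fun i _ => hg0 i τ) hIs
    have h2 : ∫ τ in (0 : ℝ)..T, ∑ i, g i τ =
        2 * (∑ i, ∫ τ in (0 : ℝ)..T, ((deriv (fun σ => p σ i) τ)⁻ + (deriv (fun σ => n σ i) τ)⁻)) +
        (K / L * (∑ i, ∫ τ in (0 : ℝ)..T,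
        (|deriv (fun σ => p σ i) τ| + |deriv (fun σ => n σ i) τ|)) +
          T * ((∑ i, (a i + b i)) / L)) := by
      rw [intervalIntegral.integral_finsetSum fun i _ => hI i]
      rw [Finset.mul_sum, Finset.mul_sum, Finset.sum_div, Finset.mul_sum, ← Finset.sum_add_distrib,
        ← Finset.sum_add_distrib]
      refine Finset.sum_congr rfl fun i _ => ?_
      simp only [hg]
      rw [intervalIntegral.integral_add (((hI1 i).const_mul 2).add ((hI2 i).const_mul (K / L)))
        intervalIntegrable_const, intervalIntegral.integral_add ((hI1 i).const_mul 2)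
        ((hI2 i).const_mul (K / L)), intervalIntegral.integral_const_mul,
        intervalIntegral.integral_const_mul, intervalIntegral.integral_const]
      simp only [smul_eq_mul, sub_zero]
      ring
    have h3 := hdiff.trans (h1.trans h2.le)
    refine (le_of_eq_of_le (by ring : _ = 2 * ((w s - z s) ⬝ᵥ M *ᵥ (w s - z s) / 2))
      (mul_le_mul_of_nonneg_left h3 two_pos.le)).trans (le_of_eq ?_)
    ring
  · intro c hc hcs
    have hwz : ∀ i, AbsolutelyContinuousOnInterval (fun τ => (w τ - z τ) i) c s := fun i =>
      (hw.absolutelyContinuous hc hcs i).fun_sub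
        ((hz.ac_pos c s hc hcs i).fun_sub (hz.ac_neg c s hc hcs i))
    have := (absolutelyContinuousOnInterval_dotProduct hwz
      (absolutelyContinuousOnInterval_mulVec M hwz)).const_mul (1 / 2)
    convert this using 2
    ring
  · filter_upwards [hz.ae_hasDerivAt] with τ hτ hmem
    have hpn := hτ hmem.1
    set p' : Fin d → ℝ := fun i => deriv (fun σ => p σ i) τ
    set n' : Fin d → ℝ := fun i => deriv (fun σ => n σ i) τ
    have hp : HasDerivAt p p' τ := hasDerivAt_pi.2 fun i => (hpn i).1
    have hn : HasDerivAt n n' τ := hasDerivAt_pi.2 fun i => (hpn i).2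
    have hder := (hasDerivAt_dotProduct_mulVec_self hM
      ((hw.hasDerivAt τ hmem.1).sub (hp.sub hn))).div_const 2
    refine ⟨_, hder, ?_⟩
    -- The `s r` parts cancel, which turns the energy derivative into a sum of scalar products of
    -- the form just estimated.
    have e : M *ᵥ (w τ - z τ) = dual M r z τ - dual M r w τ := by
      simp only [dual, mulVec_sub]; abel
    rw [mul_div_cancel_left₀ _ (two_ne_zero)]
    change (_ : Fin d → ℝ) ⬝ᵥ M *ᵥ (w τ - z τ) ≤ _
    rw [e]
    refine Finset.sum_le_sum fun i _ => ?_
    exact velocity_sub_mul_dual_sub_le hL (ha i) (hb i)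
      (hθ τ ⟨hmem.1.le, hmem.2.le.trans hsT⟩ i) (hz.abs_dual_le τ hmem.1 i)
      (hz.slack_pos τ hmem.1 i _ (hpn i).1) (hz.slack_neg τ hmem.1 i _ (hpn i).2)

end

/-! ### Comparison of the objectives. -/

noncomputable section

variable {d : ℕ}

variable {M : Matrix (Fin d) (Fin d) ℝ} {r a b y : Fin d → ℝ} {L : ℝ} {w p n : ℝ → Fin d → ℝ}

/-- The lasso objective in the variable `v = s • x`, up to the factor `s⁻²` and with the `ℓ¹` norm
left out. -/
def scaledLoss (M : Matrix (Fin d) (Fin d) ℝ) (r : Fin d → ℝ) (s : ℝ) (v : Fin d → ℝ) : ℝ :=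
  v ⬝ᵥ M *ᵥ v / 2 - s * (r ⬝ᵥ v)

/-- The explicit dependence on `s` contributes `-⟨r, v⟩`, and the gradient in `v` is minus the dual
variable. -/
lemma hasDerivAt_scaledLoss (hM : M.PosSemidef) {v : ℝ → Fin d → ℝ} {v' : Fin d → ℝ} {s : ℝ}
    (hv : HasDerivAt v v' s) :
    HasDerivAt (fun τ => scaledLoss M r τ (v τ)) (-(r ⬝ᵥ v s) - v' ⬝ᵥ dual M r v s) s := by
  refine (((hasDerivAt_dotProduct_mulVec_self hM hv).div_const 2).sub
    ((hasDerivAt_id s).mul (hasDerivAt_const_dotProduct r hv))).congr_deriv ?_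
  simp only [dual, dotProduct_sub, dotProduct_smul, smul_eq_mul, id, dotProduct_comm v' r]
  ring

lemma absolutelyContinuousOnInterval_scaledLoss {v : ℝ → Fin d → ℝ} {c e : ℝ}
    (hv : ∀ i, AbsolutelyContinuousOnInterval (fun τ => v τ i) c e) :
    AbsolutelyContinuousOnInterval (fun τ => scaledLoss M r τ (v τ)) c e := by
  have h1 := (absolutelyContinuousOnInterval_dotProduct hv
      (absolutelyContinuousOnInterval_mulVec M hv)).const_mul (1 / 2)
  have h2 := absolutelyContinuousOnInterval_dotProduct (f := fun _ => r)
    (fun i => absolutelyContinuousOnInterval_const (r i) c e) hv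
  have h3 : (fun τ => scaledLoss M r τ (v τ)) =
      fun τ => 1 / 2 * (v τ ⬝ᵥ M *ᵥ v τ) - τ * (r ⬝ᵥ v τ) := by
    funext τ
    simp only [scaledLoss]
    ring
  rw [h3]
  exact h1.fun_sub ((absolutelyContinuousOnInterval_id c e).fun_mul h2)

lemma lasso_eq_scaledLoss {s : ℝ} (hs : 0 < s) (r x : EuclideanSpace ℝ (Fin d)) :
    lasso M r x (1 / s) =
      1 / s ^ 2 * (scaledLoss M r.ofLp s (s • x.ofLp) + ∑ i, |(s • x.ofLp) i|) := by
  rw [lasso, loss_eq, scaledLoss]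
  have : ∑ i, |(s • x.ofLp) i| = s * ∑ i, |x i| := by
    rw [Finset.mul_sum]
    refine Finset.sum_congr rfl fun i _ => ?_
    rw [Pi.smul_apply, smul_eq_mul, abs_mul, abs_of_pos hs]
  rw [this]
  simp only [mulVec_smul, dotProduct_smul, smul_dotProduct, smul_eq_mul]
  field_simp

/-- The total variation of the flow, in the form of the integral of its two gains. -/
def totalGain (M : Matrix (Fin d) (Fin d) ℝ) (r a b : Fin d → ℝ) (L : ℝ) (w : ℝ → Fin d → ℝ)
    (i : Fin d) (s : ℝ) : ℝ :=
  ∫ τ in (0 : ℝ)..s, (gain L (a i) (dual M r w τ i) + gain L (b i) (-dual M r w τ i))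

lemma IsRescaledFlow.continuous_gain_add (hw : IsRescaledFlow M r a b L w) (i : Fin d) :
    Continuous fun τ => gain L (a i) (dual M r w τ i) + gain L (b i) (-dual M r w τ i) := by
  have := continuous_dual (M := M) (r := r) hw.continuous
  unfold gain
  fun_prop

lemma IsRescaledFlow.hasDerivAt_totalGain (hw : IsRescaledFlow M r a b L w) (i : Fin d) (s : ℝ) :
    HasDerivAt (totalGain M r a b L w i)
      (gain L (a i) (dual M r w s i) + gain L (b i) (-dual M r w s i)) s :=
  (hw.continuous_gain_add i).integral_hasStrictDerivAt 0 s |>.hasDerivAt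

/-- The velocity is a difference of two nonnegative gains. This replaces the nonsmooth `ℓ¹` norm of
the flow by a differentiable upper bound. -/
lemma IsRescaledFlow.abs_le_totalGain (ha : ∀ i, 0 ≤ a i) (hb : ∀ i, 0 ≤ b i)
    (hw : IsRescaledFlow M r a b L w) (i : Fin d) {s : ℝ} (hs : 0 ≤ s) :
    |w s i| ≤ totalGain M r a b L w i s := by
  have hcT : Continuous (totalGain M r a b L w i) :=
    continuous_iff_continuousAt.2 fun τ => (hw.hasDerivAt_totalGain i τ).continuousAt
  have hcw : Continuous fun τ => w τ i := (continuous_apply i).comp hw.continuous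
  have key : ∀ κ : ℝ, |κ| ≤ 1 → κ * w s i ≤ totalGain M r a b L w i s := by
    intro κ hκ
    have hder : ∀ τ, 0 < τ → HasDerivAt (fun τ => totalGain M r a b L w i τ - κ * w τ i)
        (gain L (a i) (dual M r w τ i) + gain L (b i) (-dual M r w τ i) -
          κ * velocity L a b (dual M r w τ) i) τ := fun τ hτ =>
      (hw.hasDerivAt_totalGain i τ).sub ((hasDerivAt_pi.1 (hw.hasDerivAt τ hτ) i).const_mul κ)
    have hmono : MonotoneOn (fun τ => totalGain M r a b L w i τ - κ * w τ i) (Ici 0) := by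
      refine monotoneOn_of_deriv_nonneg (convex_Ici 0)
        (hcT.sub (continuous_const.mul hcw)).continuousOn ?_ ?_
      · intro τ hτ
        rw [interior_Ici] at hτ
        exact (hder τ hτ).differentiableAt.differentiableWithinAt
      · intro τ hτ
        rw [interior_Ici] at hτ
        rw [(hder τ hτ).deriv]
        have h1 := gain_nonneg L (ha i) (dual M r w τ i)
        have h2 := gain_nonneg L (hb i) (-dual M r w τ i)
        obtain ⟨h3, h4⟩ := abs_le.1 hκ
        simp only [velocity]
        nlinarith
    have := hmono self_mem_Ici hs hs
    simp only [totalGain, intervalIntegral.integral_same, hw.zero, Pi.zero_apply, mul_zero,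
      sub_zero, sub_nonneg] at this
    exact this
  exact abs_le'.2 ⟨by simpa using key 1 (by simp), by simpa using key (-1) (by simp)⟩

/-- The lasso terms cancel by slackness; the flow terms regroup as each gain times its own slack. -/
lemma velocity_dual_cost_le {a b h k p' n' : ℝ} (hL : 0 < L) (ha : 0 ≤ a) (hb : 0 ≤ b)
    (hp : p' * (1 - k) = 0) (hn : n' * (1 + k) = 0) :
    -((gain L a h - gain L b (-h)) * h) + (gain L a h + gain L b (-h)) + (p' - n') * k - (p' + n')
      ≤ (a + b) / L := by
  have h1 := gain_mul_one_sub_le hL ha h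
  have h2 := gain_mul_one_sub_le hL hb (-h)
  rw [add_div]
  linarith

/-- The excess lasso objective of the flow is controlled by its `M`-distance to the lasso
trajectory. -/
lemma IsRescaledFlow.objective_le (hM : M.PosSemidef) (hy : M *ᵥ y = r)
    (ha : ∀ i, 0 ≤ a i) (hb : ∀ i, 0 ≤ b i)
    (hL : 0 < L) (hw : IsRescaledFlow M r a b L w) (hz : IsLassoTrajectory M r p n)
    {T R : ℝ} (hT : 0 < T)
    (hR : ∀ s ∈ Ioc 0 T, (w s - (p s - n s)) ⬝ᵥ M *ᵥ (w s - (p s - n s)) ≤ R) :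
    scaledLoss M r T (w T) + ∑ i, |w T i| ≤
      scaledLoss M r T (p T - n T) + ∑ i, (p T i + n T i) +
        T * (√(y ⬝ᵥ M *ᵥ y) * √R + (∑ i, (a i + b i)) / L) := by
  set z : ℝ → Fin d → ℝ := fun τ => p τ - n τ with hzdef
  set f : ℝ → ℝ := fun τ => scaledLoss M r τ (w τ) + ∑ i, totalGain M r a b L w i τ -
    (scaledLoss M r τ (z τ) + ∑ i, (p τ i + n τ i)) with hf
  have hlim : Tendsto f (𝓝[>] 0) (𝓝 0) := by
    have hwc := hw.continuous
    have hcT : ∀ i, Continuous (totalGain M r a b L w i) := fun i =>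
      continuous_iff_continuousAt.2 fun τ => (hw.hasDerivAt_totalGain i τ).continuousAt
    have h1 : Continuous fun τ => scaledLoss M r τ (w τ) + ∑ i, totalGain M r a b L w i τ := by
      unfold scaledLoss
      fun_prop
    have h2 := (h1.tendsto 0).mono_left (nhdsWithin_le_nhds (s := Ioi 0))
    simp only [scaledLoss, hw.zero, zero_dotProduct, dotProduct_zero, zero_div, mul_zero, sub_zero,
      totalGain, intervalIntegral.integral_same, Finset.sum_const_zero, add_zero] at h2
    refine h2.congr' ?_
    filter_upwards [hz.eventually_zero] with τ hτ
    simp [hf, hzdef, hτ.1, hτ.2, scaledLoss, totalGain]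
  have hmain := sub_le_integral_of_absolutelyContinuous (f := f) (f₀ := 0)
    (g := fun _ => √(y ⬝ᵥ M *ᵥ y) * √R + (∑ i, (a i + b i)) / L) hT ?_ hlim
    intervalIntegrable_const ?_
  · rw [intervalIntegral.integral_const, sub_zero, sub_zero, smul_eq_mul] at hmain
    have := Finset.sum_le_sum fun i (_ : i ∈ Finset.univ) => hw.abs_le_totalGain ha hb i hT.le
    have e : f T = scaledLoss M r T (w T) + ∑ i, totalGain M r a b L w i T -
      (scaledLoss M r T (p T - n T) + ∑ i, (p T i + n T i)) := rfl
    rw [e] at hmain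
    linarith
  · intro c hc hcT
    have hG : ∀ i, AbsolutelyContinuousOnInterval (totalGain M r a b L w i) c T := fun i => by
      have : ContDiff ℝ 1 (totalGain M r a b L w i) := by
        rw [contDiff_one_iff_deriv]
        refine ⟨fun τ => (hw.hasDerivAt_totalGain i τ).differentiableAt, ?_⟩
        rw [funext fun τ => (hw.hasDerivAt_totalGain i τ).deriv]
        exact hw.continuous_gain_add i
      exact this.contDiffOn.absolutelyContinuousOnInterval
    refine AbsolutelyContinuousOnInterval.fun_sub ?_ ?_
    · exact (absolutelyContinuousOnInterval_scaledLoss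
        fun i => hw.absolutelyContinuous hc hcT i).fun_add
        (absolutelyContinuousOnInterval_sum _ fun i _ => hG i)
    · exact (absolutelyContinuousOnInterval_scaledLoss
        fun i => (hz.ac_pos c T hc hcT i).fun_sub (hz.ac_neg c T hc hcT i)).fun_add
        (absolutelyContinuousOnInterval_sum _ fun i _ =>
          (hz.ac_pos c T hc hcT i).fun_add (hz.ac_neg c T hc hcT i))
  · filter_upwards [hz.ae_hasDerivAt] with τ hτ hmem
    have hpn := hτ hmem.1
    set p' : Fin d → ℝ := fun i => deriv (fun σ => p σ i) τ
    set n' : Fin d → ℝ := fun i => deriv (fun σ => n σ i) τ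
    have hp : HasDerivAt p p' τ := hasDerivAt_pi.2 fun i => (hpn i).1
    have hn : HasDerivAt n n' τ := hasDerivAt_pi.2 fun i => (hpn i).2
    have hder := ((hasDerivAt_scaledLoss (r := r) hM (hw.hasDerivAt τ hmem.1)).add
      (HasDerivAt.fun_sum fun i (_ : i ∈ Finset.univ) => hw.hasDerivAt_totalGain i τ)).sub
      ((hasDerivAt_scaledLoss (r := r) hM (hp.sub hn)).add
        (HasDerivAt.fun_sum fun i (_ : i ∈ Finset.univ) => (hpn i).1.add (hpn i).2))
    refine ⟨_, hder, ?_⟩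
    -- Here `r = M y` is essential: it makes the linear term controllable by the `M`-seminorm alone.
    have h1 : r ⬝ᵥ z τ - r ⬝ᵥ w τ ≤ √(y ⬝ᵥ M *ᵥ y) * √R := by
      have h2 := dotProduct_mulVec_le_sqrt hM y (z τ - w τ)
      have h3 : y ⬝ᵥ M *ᵥ (z τ - w τ) = r ⬝ᵥ z τ - r ⬝ᵥ w τ := by
        rw [dotProduct_mulVec_comm hM, hy, sub_dotProduct, dotProduct_comm r, dotProduct_comm r]
      have h4 : (z τ - w τ) ⬝ᵥ M *ᵥ (z τ - w τ) = (w τ - z τ) ⬝ᵥ M *ᵥ (w τ - z τ) := by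
        rw [← neg_sub (w τ), mulVec_neg, neg_dotProduct_neg]
      rw [h3, h4] at h2
      exact h2.trans (mul_le_mul_of_nonneg_left
        (Real.sqrt_le_sqrt (hR τ ⟨hmem.1, hmem.2.le⟩)) (Real.sqrt_nonneg _))
    have h5 := Finset.sum_le_sum fun i (_ : i ∈ Finset.univ) =>
      velocity_dual_cost_le (h := dual M r w τ i) hL (ha i) (hb i)
      (hz.slack_pos τ hmem.1 i _ (hpn i).1) (hz.slack_neg τ hmem.1 i _ (hpn i).2)
    rw [← Finset.sum_div] at h5
    simp only [Finset.sum_add_distrib, Finset.sum_sub_distrib, Finset.sum_neg_distrib] at h5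
    change -(r ⬝ᵥ w τ) - ∑ i, (gain L (a i) (dual M r w τ i) - gain L (b i) (-dual M r w τ i)) *
      dual M r w τ i + ∑ i, (gain L (a i) (dual M r w τ i) + gain L (b i) (-dual M r w τ i)) -
      (-(r ⬝ᵥ z τ) - ∑ i, (p' i - n' i) * dual M r z τ i + ∑ i, (p' i + n' i)) ≤ _
    simp only [Finset.sum_add_distrib]
    linarith

/-! ### From a lasso path to a lasso trajectory. -/

section LassoPath

variable {r : EuclideanSpace ℝ (Fin d)} {x : ℝ → EuclideanSpace ℝ (Fin d)}

/-- Once `1 / s` exceeds `‖r‖₁`, the penalty outweighs the linear term, so 0 is the only minimizer.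
-/
lemma IsLassoPath.eventually_eq_zero (hM : M.PosSemidef) (hx : IsLassoPath M r x) :
    ∀ᶠ s in 𝓝[>] (0 : ℝ), x s = 0 := by
  have hR : 0 ≤ ∑ i, |r i| := Finset.sum_nonneg fun _ _ => abs_nonneg _
  have hpos : 0 < 1 / (1 + ∑ i, |r i|) := by positivity
  filter_upwards [Ioo_mem_nhdsGT hpos] with s hs
  have hs1 : 1 + ∑ i, |r i| < 1 / s := by
    rw [lt_one_div (by positivity) hs.1]; exact hs.2
  have h := hx s hs.1 0
  have h0 : lasso M r 0 (1 / s) = 0 := by simp [lasso, loss]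
  rw [h0, lasso, loss_eq] at h
  have h1 := dotProduct_mulVec_self_nonneg hM (x s).ofLp
  have h2 : r.ofLp ⬝ᵥ (x s).ofLp ≤ (∑ i, |r i|) * ∑ i, |x s i| := by
    rw [Finset.mul_sum]
    refine Finset.sum_le_sum fun i _ => (le_abs_self _).trans ?_
    rw [abs_mul]
    exact mul_le_mul_of_nonneg_right
      (Finset.single_le_sum (f := fun i => |r i|) (fun _ _ => abs_nonneg _) (Finset.mem_univ i))
      (abs_nonneg _)
  have h3 : 0 ≤ ∑ i, |x s i| := Finset.sum_nonneg fun _ _ => abs_nonneg _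
  have h4 : ∑ i, |x s i| = 0 := by nlinarith
  rw [Finset.sum_eq_zero_iff_of_nonneg fun _ _ => abs_nonneg _] at h4
  ext i
  exact abs_eq_zero.1 (h4 i (Finset.mem_univ i))

lemma dual_lassoPath (s : ℝ) (i : Fin d) :
    dual M r.ofLp (fun τ => (fun i => τ * (x τ i)⁺) - fun i => τ * (x τ i)⁻) s i =
      s * (r i - (M *ᵥ (x s).ofLp) i) := by
  have : ((fun i => s * (x s i)⁺) - fun i => s * (x s i)⁻) = s • (x s).ofLp := by
    funext i
    simp only [Pi.sub_apply, Pi.smul_apply, smul_eq_mul]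
    rw [← mul_sub, posPart_sub_negPart]
  simp only [dual, this, mulVec_smul, Pi.sub_apply, Pi.smul_apply, smul_eq_mul]
  ring

lemma IsLassoPath.isLassoTrajectory (hM : M.PosSemidef) (hx : IsLassoPath M r x)
    (hac : ∀ a b : ℝ, 0 < a → a ≤ b → AbsolutelyContinuousOnInterval x a b) :
    IsLassoTrajectory M r.ofLp (fun τ i => τ * (x τ i)⁺) (fun τ i => τ * (x τ i)⁻) := by
  have hopt := fun s (hs : 0 < s) i =>
    lasso_optimality hM (one_div_nonneg.2 hs.le) (hx s hs) i
  -- Slackness at an inactive part: a nonnegative function that vanishes at `s` has a minimum there,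
  -- so its derivative is zero.
  have hderiv : ∀ {g : ℝ → ℝ} {s g' : ℝ}, 0 < s → (∀ τ, 0 < τ → 0 ≤ g τ) → g s = 0 →
      HasDerivAt g g' s → g' = 0 := by
    intro g s g' hs hg hgs hd
    refine IsLocalMin.hasDerivAt_eq_zero ?_ hd
    filter_upwards [lt_mem_nhds hs] with τ hτ
    rw [hgs]
    exact hg τ hτ
  have hlip : ∀ i, LipschitzWith 1 fun z : EuclideanSpace ℝ (Fin d) => z i := fun i =>
    LipschitzWith.of_dist_le_mul fun z z' => by
      rw [NNReal.coe_one, one_mul, dist_eq_norm, dist_eq_norm]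
      exact PiLp.norm_apply_le (z - z') i
  refine ⟨fun s hs i => ?_, fun s hs i p' hp => ?_, fun s hs i n' hn => ?_,
    fun a b ha hab i => ?_, fun a b ha hab i => ?_, ?_⟩
  · rw [dual_lassoPath, abs_mul, abs_of_pos hs]
    calc s * |r i - (M *ᵥ (x s).ofLp) i| ≤ s * (1 / s) :=
          mul_le_mul_of_nonneg_left (hopt s hs i).1 hs.le
      _ = 1 := mul_one_div_cancel hs.ne'
  · rw [dual_lassoPath]
    rcases lt_or_ge 0 (x s i) with h | h
    · rw [(hopt s hs i).2.1 h, mul_one_div_cancel hs.ne', sub_self, mul_zero]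
    · rw [hderiv hs (fun τ hτ => mul_nonneg hτ.le (posPart_nonneg _))
        (by simp only [posPart_of_nonpos h, mul_zero]) hp, zero_mul]
  · rw [dual_lassoPath]
    rcases lt_or_ge (x s i) 0 with h | h
    · rw [(hopt s hs i).2.2 h, mul_neg, mul_one_div_cancel hs.ne', add_neg_cancel, mul_zero]
    · rw [hderiv hs (fun τ hτ => mul_nonneg hτ.le (negPart_nonneg _))
        (by simp only [negPart_of_nonneg h, mul_zero]) hn, zero_mul]
  · refine (absolutelyContinuousOnInterval_id a b).fun_mul ?_
    exact absolutelyContinuousOnInterval_comp_lipschitz (K := 1) (φ := fun t : ℝ => t⁺)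
      ((LipschitzWith.id (α := ℝ)).max_const 0)
      (absolutelyContinuousOnInterval_comp_lipschitz (hlip i) (hac a b ha hab))
  · refine (absolutelyContinuousOnInterval_id a b).fun_mul ?_
    exact absolutelyContinuousOnInterval_comp_lipschitz (K := 1) (φ := fun t : ℝ => t⁻)
      ((LipschitzWith.id (α := ℝ)).neg.max_const 0)
      (absolutelyContinuousOnInterval_comp_lipschitz (hlip i) (hac a b ha hab))
  · filter_upwards [hx.eventually_eq_zero hM] with s hs
    constructor <;> funext i <;> simp [hs]

lemma IsLassoPath.lassoMin_eq (hx : IsLassoPath M r x) {s : ℝ} (hs : 0 < s) :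
    lassoMin M r (1 / s) = lasso M r (x s) (1 / s) :=
  le_antisymm (ciInf_le ⟨_, Set.forall_mem_range.2 (hx s hs)⟩ (x s)) (le_ciInf (hx s hs))

end LassoPath

end

/-! ### From the gradient flow to the rescaled flow. -/

noncomputable section

variable {d : ℕ}

section Gradient

variable {M : Matrix (Fin d) (Fin d) ℝ} {r : EuclideanSpace ℝ (Fin d)}

lemma hasGradientAt_loss_hadamard (hM : M.PosSemidef) (r u v : EuclideanSpace ℝ (Fin d)) :
    HasGradientAt (fun z => loss M r (hadamard z v))
      (hadamard (Matrix.toEuclideanLin M (hadamard u v) - r) v) u := by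
  rw [hasGradientAt_iff_hasFDerivAt]
  set H : EuclideanSpace ℝ (Fin d) →L[ℝ] EuclideanSpace ℝ (Fin d) :=
    LinearMap.toContinuousLinearMap
      { toFun := fun z => hadamard z v
        map_add' := fun z z' => by ext i; simp [hadamard, add_mul]
        map_smul' := fun c z => by ext i; simp [hadamard, mul_assoc] } with hH
  set A : EuclideanSpace ℝ (Fin d) →L[ℝ] EuclideanSpace ℝ (Fin d) :=
    LinearMap.toContinuousLinearMap (Matrix.toEuclideanLin M) with hA
  have hHu : ∀ z, H z = hadamard z v := fun z => rfl
  have h1 : HasFDerivAt (fun z => H z) H u := H.hasFDerivAt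
  have h2 : HasFDerivAt (fun z => A (H z)) (A.comp H) u := (A.comp H).hasFDerivAt
  have h3 := ((h1.inner ℝ h2).const_mul (1 / 2)).sub ((hasFDerivAt_const r u).inner ℝ h1)
  refine h3.congr_fderiv ?_
  ext z
  have hsymm := dotProduct_mulVec_comm hM (hadamard z v).ofLp (hadamard u v).ofLp
  have e : ∀ c : EuclideanSpace ℝ (Fin d), inner ℝ (hadamard c v) z = inner ℝ c (hadamard z v) := by
    intro c
    simp only [EuclideanSpace.inner_eq_star_dotProduct, hadamard, dotProduct]
    refine Finset.sum_congr rfl fun i _ => ?_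
    simp only [star_trivial, Pi.star_apply]
    ring
  have e1 : inner ℝ (Matrix.toEuclideanLin M (hadamard u v)) (hadamard z v) =
      (hadamard z v).ofLp ⬝ᵥ M *ᵥ (hadamard u v).ofLp := by
    simp [EuclideanSpace.inner_eq_star_dotProduct]
  have e2 : inner ℝ (hadamard u v) (Matrix.toEuclideanLin M (hadamard z v)) =
      (hadamard u v).ofLp ⬝ᵥ M *ᵥ (hadamard z v).ofLp := by
    simp [EuclideanSpace.inner_eq_star_dotProduct, dotProduct_comm]
  simp only [InnerProductSpace.toDual_apply_apply, e, inner_sub_left, e1]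
  simp [hHu, hA, e2, hsymm]
  rw [← real_inner_comm, e1, hsymm]
  ring

lemma hadamard_comm (u v : EuclideanSpace ℝ (Fin d)) : hadamard u v = hadamard v u := by
  ext i
  simp [hadamard, mul_comm]

variable {u₀ v₀ : EuclideanSpace ℝ (Fin d)} {u v : ℝ → EuclideanSpace ℝ (Fin d)}

lemma IsGradientFlow.hasDerivWithinAt_apply (hM : M.PosSemidef)
    (h : IsGradientFlow M r u₀ v₀ u v) {t : ℝ} (ht : 0 ≤ t) (i : Fin d) :
    HasDerivWithinAt (fun τ => u τ i)
      (-(((M *ᵥ (hadamard (u t) (v t)).ofLp) i - r i) * v t i)) (Ici 0) t ∧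
    HasDerivWithinAt (fun τ => v τ i)
      (-(((M *ᵥ (hadamard (u t) (v t)).ofLp) i - r i) * u t i)) (Ici 0) t := by
  constructor
  · have h1 := h.deriv_u t ht
    rw [(hasGradientAt_loss_hadamard hM r (u t) (v t)).gradient] at h1
    exact ((EuclideanSpace.proj (𝕜 := ℝ) i).hasFDerivAt.comp_hasDerivWithinAt t h1)
  · have h1 := h.deriv_v t ht
    simp only [hadamard_comm (u t)] at h1
    rw [(hasGradientAt_loss_hadamard hM r (v t) (u t)).gradient] at h1
    have := (EuclideanSpace.proj (𝕜 := ℝ) i).hasFDerivAt.comp_hasDerivWithinAt t h1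
    rwa [hadamard_comm (u t)]

/-- Product of the two factors of the gradient flow, extended to negative times by a constant. -/
def extendedProduct (u v : ℝ → EuclideanSpace ℝ (Fin d)) (t : ℝ) : Fin d → ℝ :=
  fun i => u (max t 0) i * v (max t 0) i

lemma IsGradientFlow.continuous_extendedProduct (h : IsGradientFlow M r u₀ v₀ u v) :
    Continuous (extendedProduct u v) := by
  have hu : ContinuousOn u (Ici 0) := fun t ht => (h.deriv_u t ht).continuousWithinAt
  have hv : ContinuousOn v (Ici 0) := fun t ht => (h.deriv_v t ht).continuousWithinAt
  have hm : Continuous fun t : ℝ => max t 0 := by fun_prop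
  have hu' : Continuous fun t => u (max t 0) := hu.comp_continuous hm fun t => le_max_right t 0
  have hv' : Continuous fun t => v (max t 0) := hv.comp_continuous hm fun t => le_max_right t 0
  refine continuous_pi fun i => ?_
  exact ((EuclideanSpace.proj (𝕜 := ℝ) i).continuous.comp hu').mul
    ((EuclideanSpace.proj (𝕜 := ℝ) i).continuous.comp hv')

/-- The integral of the product of the two factors of the gradient flow. -/
def integratedProduct (u v : ℝ → EuclideanSpace ℝ (Fin d)) (t : ℝ) : Fin d → ℝ :=
  fun i => ∫ τ in (0 : ℝ)..t, extendedProduct u v τ i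

lemma IsGradientFlow.hasDerivAt_integratedProduct (h : IsGradientFlow M r u₀ v₀ u v) (t : ℝ) :
    HasDerivAt (integratedProduct u v) (extendedProduct u v t) t :=
  hasDerivAt_pi.2 fun i => (((continuous_apply i).comp
    h.continuous_extendedProduct).integral_hasStrictDerivAt 0 t).hasDerivAt

lemma IsGradientFlow.avgIterate_eq (h : IsGradientFlow M r u₀ v₀ u v) {t : ℝ} (ht : 0 ≤ t) :
    (avgIterate u v t).ofLp = (1 / t) • integratedProduct u v t := by
  have hu : ContinuousOn u (Ici 0) := fun t ht => (h.deriv_u t ht).continuousWithinAt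
  have hv : ContinuousOn v (Ici 0) := fun t ht => (h.deriv_v t ht).continuousWithinAt
  have hc : ContinuousOn (fun τ => hadamard (u τ) (v τ)) (uIcc 0 t) := by
    rw [uIcc_of_le ht]
    have hu' : ContinuousOn u (Icc 0 t) := hu.mono fun τ hτ => hτ.1
    have hv' : ContinuousOn v (Icc 0 t) := hv.mono fun τ hτ => hτ.1
    unfold hadamard
    fun_prop
  funext i
  have h1 := (EuclideanSpace.proj (𝕜 := ℝ) i).intervalIntegral_comp_comm
    (μ := volume) (f := fun τ => hadamard (u τ) (v τ)) (a := 0) (b := t) hc.intervalIntegrable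
  have h2 : integratedProduct u v t i =
      ∫ τ in (0 : ℝ)..t, (EuclideanSpace.proj (𝕜 := ℝ) i) (hadamard (u τ) (v τ)) := by
    refine intervalIntegral.integral_congr fun τ hτ => ?_
    rw [uIcc_of_le ht] at hτ
    simp [extendedProduct, hadamard, max_eq_left hτ.1]
  rw [Pi.smul_apply, h2, h1]
  simp [avgIterate]

/-- The multiplicative form of the gradient flow: the sum and the difference of the two factors
evolve by exponentials of the integrated gradient of the loss. -/
lemma IsGradientFlow.extendedProduct_eq (hM : M.PosSemidef)
    (h : IsGradientFlow M r u₀ v₀ u v) {t : ℝ} (ht : 0 ≤ t) (i : Fin d) :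
    extendedProduct u v t i =
      (u₀ i + v₀ i) ^ 2 / 4 * Real.exp (-(2 * ((M *ᵥ integratedProduct u v t) i - t * r i))) -
      (u₀ i - v₀ i) ^ 2 / 4 * Real.exp (2 * ((M *ᵥ integratedProduct u v t) i - t * r i)) := by
  set Γ : ℝ → ℝ := fun t => (M *ᵥ integratedProduct u v t) i - t * r i with hΓ
  have hΓd : ∀ τ, 0 ≤ τ →
      HasDerivAt Γ ((M *ᵥ (hadamard (u τ) (v τ)).ofLp) i - r i) τ := by
    intro τ hτ
    have e : (hadamard (u τ) (v τ)).ofLp = extendedProduct u v τ := by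
      funext j; simp [hadamard, extendedProduct, max_eq_left hτ]
    have h1 := hasDerivAt_pi.1 (h.hasDerivAt_integratedProduct τ)
    have h2 : HasDerivAt (fun t => (M *ᵥ integratedProduct u v t) i)
        ((M *ᵥ extendedProduct u v τ) i) τ := by
      simp only [mulVec, dotProduct]
      exact HasDerivAt.fun_sum fun j _ => (h1 j).const_mul (M i j)
    rw [e]
    exact (h2.sub ((hasDerivAt_id τ).mul_const (r i))).congr_deriv (by simp)
  have hΓ0 : Γ 0 = 0 := by
    have : integratedProduct u v 0 = 0 := by funext j; simp [integratedProduct]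
    simp [hΓ, this]
  -- For `κ = ±1` the combination `u + κ v` diagonalizes the system: its logarithmic derivative is
  -- `-κ Γ'`.
  have key : ∀ κ : ℝ, κ ^ 2 = 1 →
      (u t i + κ * v t i) * Real.exp (κ * Γ t) = u₀ i + κ * v₀ i := by
    intro κ hκ
    have hder : ∀ τ, 0 ≤ τ → HasDerivWithinAt
        (fun τ => (u τ i + κ * v τ i) * Real.exp (κ * Γ τ)) 0 (Ici 0) τ := by
      intro τ hτ
      obtain ⟨hu, hv⟩ := h.hasDerivWithinAt_apply hM hτ i
      refine ((hu.add (hv.const_mul κ)).mul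
        (((hΓd τ hτ).hasDerivWithinAt.const_mul κ).exp)).congr_deriv ?_
      linear_combination (norm := skip) Real.exp (κ * Γ τ) * v τ i *
        ((M *ᵥ (hadamard (u τ) (v τ)).ofLp) i - r i) * hκ
      simp only [Pi.add_apply]
      ring
    have hconst := constant_of_has_deriv_right_zero (a := 0) (b := t)
      (f := fun τ => (u τ i + κ * v τ i) * Real.exp (κ * Γ τ))
      (fun τ hτ => ((hder τ hτ.1).continuousWithinAt).mono Icc_subset_Ici_self)
      (fun τ hτ => (hder τ hτ.1).mono (Ici_subset_Ici.2 hτ.1)) t ⟨ht, le_rfl⟩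
    simpa [hΓ0, h.init_u, h.init_v] using hconst
  have h1 := key 1 (by norm_num)
  have h2 := key (-1) (by norm_num)
  have h3 : u t i + v t i = (u₀ i + v₀ i) * Real.exp (-Γ t) := by
    rw [Real.exp_neg, ← div_eq_mul_inv, eq_div_iff (Real.exp_pos _).ne']
    simpa using h1
  have h4 : u t i - v t i = (u₀ i - v₀ i) * Real.exp (Γ t) := by
    rw [← neg_neg (Γ t), Real.exp_neg, ← div_eq_mul_inv, eq_div_iff (Real.exp_pos _).ne']
    simpa [← sub_eq_add_neg] using h2
  have h5 : extendedProduct u v t i = u t i * v t i := by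
    simp [extendedProduct, max_eq_left ht]
  have h6 : ∀ c : ℝ, Real.exp (2 * c) = Real.exp c ^ 2 := fun c => by
    rw [← Real.exp_nat_mul]; norm_num
  have h7 : u t i * v t i = ((u t i + v t i) ^ 2 - (u t i - v t i) ^ 2) / 4 := by ring
  rw [h5, h7, h3, h4, ← mul_neg, h6, h6]
  ring

/-- The rescaled integrated trajectory `s ↦ (2 / L) ∫₀^{L s / 2} u ∘ v`. -/
def rescaledTrajectory (u v : ℝ → EuclideanSpace ℝ (Fin d)) (L s : ℝ) : Fin d → ℝ :=
  (2 / L) • integratedProduct u v (L / 2 * s)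

/-- The initial scale `ε = e^{-L}` combines with the factors `e^{±Lθ}` of the multiplicative form to
give the two gains. -/
lemma IsGradientFlow.isRescaledFlow (hM : M.PosSemidef) {β γ : EuclideanSpace ℝ (Fin d)} {L : ℝ}
    (hL : 0 < L)
    (h : IsGradientFlow M r (√(Real.exp (-L)) • β) (√(Real.exp (-L)) • γ) u v) :
    IsRescaledFlow M r.ofLp (fun i => (β i + γ i) ^ 2 / 4) (fun i => (β i - γ i) ^ 2 / 4) L
      (rescaledTrajectory u v L) := by
  have hder : ∀ s, HasDerivAt (rescaledTrajectory u v L) (extendedProduct u v (L / 2 * s)) s := by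
    intro s
    have h1 := (h.hasDerivAt_integratedProduct (L / 2 * s)).scomp s
      ((hasDerivAt_id s).const_mul (L / 2))
    refine (h1.const_smul (2 / L)).congr_deriv ?_
    rw [smul_smul, mul_one, div_mul_div_cancel₀ hL.ne', div_self two_ne_zero, one_smul]
  refine ⟨?_, continuous_iff_continuousAt.2 fun s => (hder s).continuousAt, fun s hs => ?_⟩
  · funext i
    simp [rescaledTrajectory, integratedProduct]
  · refine (hder s).congr_deriv ?_
    funext i
    rw [h.extendedProduct_eq hM (by positivity)]
    have hd : 2 * ((M *ᵥ integratedProduct u v (L / 2 * s)) i - L / 2 * s * r i) =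
        -(L * dual M r.ofLp (rescaledTrajectory u v L) s i) := by
      simp only [dual, rescaledTrajectory, mulVec_smul, Pi.sub_apply, Pi.smul_apply, smul_eq_mul]
      field_simp
      ring
    have hsq : √(Real.exp (-L)) ^ 2 = Real.exp (-L) := Real.sq_sqrt (Real.exp_pos _).le
    rw [hd]
    simp only [velocity, gain, PiLp.smul_apply, smul_eq_mul, ← mul_add, ← mul_sub, mul_pow, hsq]
    set θ := dual M r.ofLp (rescaledTrajectory u v L) s i
    have e1 : Real.exp (-(L * (1 - θ))) = Real.exp (-L) * Real.exp (- -(L * θ)) := by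
      rw [← Real.exp_add]; ring_nf
    have e2 : Real.exp (-(L * (1 - -θ))) = Real.exp (-L) * Real.exp (-(L * θ)) := by
      rw [← Real.exp_add]; ring_nf
    rw [e1, e2]
    ring

end Gradient

/-! ### Assembling the estimates. -/

section Main

variable {M : Matrix (Fin d) (Fin d) ℝ} {r : EuclideanSpace ℝ (Fin d)}

/-- The excess lasso objective of the averaged gradient flow, up to terms that vanish as the
initialization scale tends to zero. -/
lemma exists_lasso_avgIterate_le (hM : M.PosSemidef) {y : Fin d → ℝ} (hy : M *ᵥ y = r.ofLp)
    {β γ : EuclideanSpace ℝ (Fin d)} (hβγ : ∀ i, β i ≠ γ i ∧ β i ≠ -γ i)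
    {x : ℝ → EuclideanSpace ℝ (Fin d)} (hx : IsLassoPath M r x)
    (hac : ∀ a b : ℝ, 0 < a → a ≤ b → AbsolutelyContinuousOnInterval x a b)
    {s : ℝ} (hs : 0 < s) :
    ∃ κ κ' : ℝ, ∀ᶠ ε in 𝓝[>] (0 : ℝ), ∀ u v : ℝ → EuclideanSpace ℝ (Fin d),
      IsGradientFlow M r (√ε • β) (√ε • γ) u v →
      lasso M r (avgIterate u v (originalTime ε s)) (1 / s) ≤ lassoMin M r (1 / s) +
        1 / s * (√(y ⬝ᵥ M *ᵥ y) * √(4 * zDown x s + κ / Real.log (1 / ε)) +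
          κ' / Real.log (1 / ε)) := by
  set a : Fin d → ℝ := fun i => (β i + γ i) ^ 2 / 4 with ha
  set b : Fin d → ℝ := fun i => (β i - γ i) ^ 2 / 4 with hb
  have ha0 : ∀ i, 0 < a i := fun i => by
    have : β i + γ i ≠ 0 := fun h => (hβγ i).2 (eq_neg_of_add_eq_zero_left h)
    positivity
  have hb0 : ∀ i, 0 < b i := fun i => by
    have : β i - γ i ≠ 0 := sub_ne_zero.2 (hβγ i).1
    positivity
  have hz := hx.isLassoTrajectory hM hac
  set p : ℝ → Fin d → ℝ := fun τ i => τ * (x τ i)⁺ with hp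
  set n : ℝ → Fin d → ℝ := fun τ i => τ * (x τ i)⁻ with hn
  -- The initial velocity is `ε (a - b)`, so its energy relative to `y` tends to that of `y`; the
  -- extra 1 gives a bound uniform in small `ε`.
  obtain ⟨K, hK, hKb⟩ := IsRescaledFlow.abs_dual_le hM hy ha0 hb0 s (y ⬝ᵥ M *ᵥ y + 1)
  refine ⟨2 * (K * (∑ i, ∫ τ in (0 : ℝ)..s,
    (|deriv (fun σ => p σ i) τ| + |deriv (fun σ => n σ i) τ|)) + s * ∑ i, (a i + b i)),
    ∑ i, (a i + b i), ?_⟩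
  have hsmall : ∀ᶠ ε in 𝓝[>] (0 : ℝ),
      (ε • (a - b) - y) ⬝ᵥ M *ᵥ (ε • (a - b) - y) < y ⬝ᵥ M *ᵥ y + 1 := by
    have hc : Continuous fun ε : ℝ => (ε • (a - b) - y) ⬝ᵥ M *ᵥ (ε • (a - b) - y) := by fun_prop
    refine ((hc.tendsto 0).mono_left nhdsWithin_le_nhds).eventually_lt_const ?_
    simp [mulVec_neg]
  -- Taking `ε < e^{-1}` ensures `L ≥ 1`, as the bound on the dual variable requires.
  filter_upwards [hsmall, Ioo_mem_nhdsGT (Real.exp_pos (-1))] with ε hε hε1 u v huv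
  set L := Real.log (1 / ε) with hLdef
  have hεL : ε = Real.exp (-L) := by
    rw [hLdef, one_div, Real.log_inv, neg_neg, Real.exp_log hε1.1]
  have hL : 1 ≤ L := by
    have h1 := hε1.2
    rw [hεL, Real.exp_lt_exp] at h1
    linarith
  have hL0 : 0 < L := by linarith
  rw [hεL] at huv
  have hw := huv.isRescaledFlow hM hL0
  set w := rescaledTrajectory u v L with hwdef
  have h0 : velocity L a b 0 = ε • (a - b) := by
    funext i
    simp only [velocity, gain, Pi.zero_apply, neg_zero, sub_zero, mul_one, ← hεL, Pi.smul_apply,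
      Pi.sub_apply, smul_eq_mul]
    ring
  have hθ := hKb L w hL hw (by rw [h0]; exact hε.le)
  have hobj := hw.objective_le hM hy (fun i => (ha0 i).le) (fun i => (hb0 i).le) hL0 hz hs
    fun σ hσ => hw.energy_le hM (fun i => (ha0 i).le) (fun i => (hb0 i).le) hL0 hz hK hθ hσ.1 hσ.2
  have hzx : p s - n s = s • (x s).ofLp := by
    funext i
    simp only [hp, hn, Pi.sub_apply, Pi.smul_apply, smul_eq_mul]
    rw [← mul_sub, posPart_sub_negPart]
  have hzabs : ∑ i, (p s i + n s i) = ∑ i, |(s • (x s).ofLp) i| := by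
    refine Finset.sum_congr rfl fun i _ => ?_
    simp only [hp, hn]
    rw [← mul_add, posPart_add_negPart, Pi.smul_apply, smul_eq_mul, abs_mul, abs_of_pos hs]
  have hwx : w s = s • (avgIterate u v (originalTime ε s)).ofLp := by
    have ht : originalTime ε s = L / 2 * s := rfl
    rw [ht, huv.avgIterate_eq (by positivity), hwdef, rescaledTrajectory, smul_smul]
    congr 1
    field_simp
  rw [hx.lassoMin_eq hs, lasso_eq_scaledLoss hs, lasso_eq_scaledLoss hs, ← hwx]
  rw [hzx, hzabs] at hobj
  have hfin := mul_le_mul_of_nonneg_left hobj (by positivity : 0 ≤ 1 / s ^ 2)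
  refine hfin.trans (le_of_eq ?_)
  rw [mul_add]
  congr 1
  rw [← mul_assoc]
  congr 1
  field_simp

end Main

end
end DLN

theorem theorem2 (d : ℕ) (M : Matrix (Fin d) (Fin d) ℝ) (hM : M.PosSemidef)
    (r : EuclideanSpace ℝ (Fin d)) (hr : r ∈ LinearMap.range (Matrix.toEuclideanLin M))
    (β γ : EuclideanSpace ℝ (Fin d)) (hβγ : ∀ i, β i ≠ γ i ∧ β i ≠ -γ i) :
    ∃ C : ℝ, 0 < C ∧
      ∀ x : ℝ → EuclideanSpace ℝ (Fin d), DLN.IsLassoPath M r x →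
        (∀ a b : ℝ, 0 < a → a ≤ b → AbsolutelyContinuousOnInterval x a b) →
        ∀ u v : ℝ → ℝ → EuclideanSpace ℝ (Fin d),
          (∀ᶠ ε in 𝓝[>] (0 : ℝ),
            DLN.IsGradientFlow M r (Real.sqrt ε • β) (Real.sqrt ε • γ) (u ε) (v ε)) →
          ∀ s : ℝ, 0 < s →
            limsup
              (fun ε : ℝ =>
                ((DLN.lasso M r (DLN.avgIterate (u ε) (v ε) (DLN.originalTime ε s)) (1 / s) : ℝ)
                  : EReal))
              (𝓝[>] (0 : ℝ)) ≤
            ((DLN.lassoMin M r (1 / s) +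
                C * (Real.sqrt (1 + s) / s * Real.sqrt (DLN.zDown x s) +
                  (1 + s) / s ^ 2 * DLN.zDown x s) : ℝ) : EReal) := by
  obtain ⟨y, hy⟩ := hr
  have hy' : M.mulVec y.ofLp = r.ofLp := by rw [← hy]; rfl
  set N := Real.sqrt (y.ofLp ⬝ᵥ M.mulVec y.ofLp) with hN
  have hN0 : 0 ≤ N := Real.sqrt_nonneg _
  -- The 2 is the square root of the 4 in front of `z↓`; the added 1 keeps the constant positive
  -- when `N = 0`.
  refine ⟨2 * N + 1, by positivity, fun x hx hac u v huv s hs => ?_⟩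
  obtain ⟨κ, κ', hev⟩ := DLN.exists_lasso_avgIterate_le hM hy' hβγ hx hac hs
  have hlog : Tendsto (fun ε : ℝ => Real.log (1 / ε)) (𝓝[>] 0) atTop := by
    simp only [one_div]
    exact Real.tendsto_log_atTop.comp tendsto_inv_nhdsGT_zero
  have hdiv : ∀ c : ℝ, Tendsto (fun ε : ℝ => c / Real.log (1 / ε)) (𝓝[>] 0) (𝓝 0) :=
    fun c => hlog.const_div_atTop c
  have hlim : Tendsto (fun ε : ℝ => DLN.lassoMin M r (1 / s) +
      1 / s * (N * Real.sqrt (4 * DLN.zDown x s + κ / Real.log (1 / ε)) +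
        κ' / Real.log (1 / ε))) (𝓝[>] 0)
      (𝓝 (DLN.lassoMin M r (1 / s) +
        1 / s * (N * Real.sqrt (4 * DLN.zDown x s + 0) + 0))) :=
    ((((((hdiv κ).const_add _).sqrt).const_mul N).add (hdiv κ')).const_mul _).const_add _
  have hlimE := (continuous_coe_real_ereal.tendsto _).comp hlim
  refine (limsup_le_limsup ?_).trans ((hlimE.limsup_eq).le.trans ?_)
  · filter_upwards [hev, huv] with ε h1 h2
    exact EReal.coe_le_coe_iff.2 (h1 _ _ h2)
  · have hz0 : 0 ≤ DLN.zDown x s := Finset.sum_nonneg fun i _ =>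
      intervalIntegral.integral_nonneg hs.le fun τ _ =>
        add_nonneg (negPart_nonneg _) (negPart_nonneg _)
    have h4 : Real.sqrt (4 * DLN.zDown x s) = 2 * Real.sqrt (DLN.zDown x s) := by
      rw [Real.sqrt_mul (by norm_num), show (4 : ℝ) = 2 ^ 2 by norm_num,
        Real.sqrt_sq (by norm_num)]
    have h1 : 1 ≤ Real.sqrt (1 + s) := Real.one_le_sqrt.2 (by linarith)
    have hS := Real.sqrt_nonneg (DLN.zDown x s)
    rw [EReal.coe_le_coe_iff, add_zero, add_zero, h4]
    -- The limit bound is already of the form `2 N √z↓ / s`; the factor `√(1 + s) ≥ 1` and the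
    -- nonnegative second term only enlarge the right-hand side.
    have hA : Real.sqrt (DLN.zDown x s) / s ≤
        Real.sqrt (1 + s) / s * Real.sqrt (DLN.zDown x s) := by
      rw [div_mul_eq_mul_div]
      exact div_le_div_of_nonneg_right (le_mul_of_one_le_left hS h1) hs.le
    have hB : 0 ≤ (1 + s) / s ^ 2 * DLN.zDown x s := by positivity
    have hA0 : 0 ≤ Real.sqrt (DLN.zDown x s) / s := by positivity
    have e : 1 / s * (N * (2 * Real.sqrt (DLN.zDown x s))) =
        2 * N * (Real.sqrt (DLN.zDown x s) / s) := by ring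
    rw [e]
    gcongr
    · linarith
    · linarith
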